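/- Let $P=\{p_1,\dots,p_n\}$ be a set of $n\ge 3$ distinct sites in the plane in general position (no three on a common line, no four on a common circle). The sites are stored, in arbitrary order, in a read-only array with random access, and their coordinates are integers of $O(\log n)$ bits. For $p\ne q$ in $P$, the edge for $p,q$ of the nearest-site Voronoi diagram $\mathrm{NVD}(P)$ (of the farthest-site Voronoi diagram $\mathrm{FVD}(P)$) is the set of all points of the plane that have $p$ and $q$ as their only two nearest (farthest) sites in $P$, whenever this set is non-empty. Then there is a deterministic word RAM algorithm that reports all the edges of $\mathrm{NVD}(P)$, each exactly once, in $O(n^2)$ time using $O(1)$ words of workspace, where a word has $\Theta(\log n)$ bits. The same holds for $\mathrm{FVD}(P)$. Here the output is write-only, and an edge is reported by writing the indices of its two sites together with its two ends in homogeneous coordinates (a point for a finite end, a direction for the infinite end of a halfline). More precisely, there are a single program with a constant number of registers and a constant $C$ such that, for every $b$, there is a $c$ for which the program works on all such inputs with coordinates of absolute value at most $n^b$: it makes at most $Cn^2$ steps, and no register ever holds a number of absolute value above $n^c$. -/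

import Mathlib

namespace VoronoiRAM

/-! ### Sites and Voronoi diagrams in the Euclidean plane -/

/-- The Euclidean plane. -/
abbrev Plane : Type := EuclideanSpace ℝ (Fin 2)

/-- The sites are pairwise distinct, no three lie on a common line, and no four lie on a common
circle. -/
structure GeneralPosition {n : ℕ} (p : Fin n → Plane) : Prop where
  injective : Function.Injective p
  no_three_on_line : ∀ i j k : Fin n, i ≠ j → i ≠ k → j ≠ k → ¬ Collinear ℝ {p i, p j, p k}
  no_four_on_circle : ∀ i j k l : Fin n, i ≠ j → i ≠ k → i ≠ l → j ≠ k → j ≠ l → k ≠ l →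
    ¬ EuclideanGeometry.Cospherical ({p i, p j, p k, p l} : Set Plane)

/-- The indices of the sites nearest to `z`. -/
def nearestSites {n : ℕ} (p : Fin n → Plane) (z : Plane) : Set (Fin n) :=
  {i | ∀ j, dist z (p i) ≤ dist z (p j)}

/-- The indices of the sites farthest from `z`. -/
def farthestSites {n : ℕ} (p : Fin n → Plane) (z : Plane) : Set (Fin n) :=
  {i | ∀ j, dist z (p j) ≤ dist z (p i)}

/-- For `i ≠ j`: the points that have `p i` and `p j` as their only two nearest sites. If this set
is non-empty, it is the edge for `p i` and `p j` of the nearest-site Voronoi diagram. -/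
def nvdEdge {n : ℕ} (p : Fin n → Plane) (i j : Fin n) : Set Plane :=
  {z | nearestSites p z = {i, j}}

/-- For `i ≠ j`: the points that have `p i` and `p j` as their only two farthest sites. If this set
is non-empty, it is the edge for `p i` and `p j` of the farthest-site Voronoi diagram. -/
def fvdEdge {n : ℕ} (p : Fin n → Plane) (i j : Fin n) : Set Plane :=
  {z | farthestSites p z = {i, j}}

/-! ### The word RAM with read-only input and write-only output -/

/-- The read-only input: an array of `n` sites with integer coordinates. -/
structure Sites (n : ℕ) where
  x : Fin n → ℤ
  y : Fin n → ℤ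

/-- The points of the plane stored in the array. -/
noncomputable def Sites.point {n : ℕ} (P : Sites n) (i : Fin n) : Plane :=
  !₂[(P.x i : ℝ), (P.y i : ℝ)]

/-- The constant-size description of an edge that is written to the output: the indices of its two
sites (counted from `0`), and its two ends in homogeneous coordinates `(x₁ : y₁ : w₁)` and
`(x₂ : y₂ : w₂)`. -/
structure EdgeRecord (α : Type) where
  site₁ : α
  site₂ : α
  x₁ : α
  y₁ : α
  w₁ : α
  x₂ : α
  y₂ : α
  w₂ : α

def EdgeRecord.map {α β : Type} (f : α → β) (r : EdgeRecord α) : EdgeRecord β :=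
  ⟨f r.site₁, f r.site₂, f r.x₁, f r.y₁, f r.w₁, f r.x₂, f r.y₂, f r.w₂⟩

/-- Binary operations on (signed) words. -/
inductive ArithOp where
  | add | sub | mul | div | mod | and | or | xor | shiftLeft | shiftRight

/-- Division and remainder are Euclidean, with Lean's conventions for divisor `0`; the bit operations
use two's complement. -/
def ArithOp.eval : ArithOp → ℤ → ℤ → ℤ
  | add, a, b => a + b
  | sub, a, b => a - b
  | mul, a, b => a * b
  | div, a, b => a / b
  | mod, a, b => a % b
  | and, a, b => Int.land a b
  | or, a, b => Int.lor a b
  | xor, a, b => Int.xor a b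
  | shiftLeft, a, b => a * 2 ^ b.toNat
  | shiftRight, a, b => a / 2 ^ b.toNat

/-- Instructions of a machine whose whole workspace consists of `k` registers (and the program
counter). -/
inductive Instr (k : ℕ) where
  /-- write a fixed number to register `d` -/
  | const (d : Fin k) (v : ℤ)
  /-- copy register `a` to register `d` -/
  | copy (d a : Fin k)
  /-- apply `op` to registers `a` and `b`, and write the result to register `d` -/
  | arith (op : ArithOp) (d a b : Fin k)
  /-- write the number of sites to register `d` -/
  | size (d : Fin k)
  /-- write the first coordinate of the site whose index is in register `a` to register `d` -/
  | loadX (d a : Fin k)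
  /-- write the second coordinate of the site whose index is in register `a` to register `d` -/
  | loadY (d a : Fin k)
  /-- go to instruction `t` -/
  | jump (t : ℕ)
  /-- go to instruction `t` if register `a` is less than register `b` -/
  | jumpLt (a b : Fin k) (t : ℕ)
  /-- go to instruction `t` if registers `a` and `b` are equal -/
  | jumpEq (a b : Fin k) (t : ℕ)
  /-- append to the output the edge record that is held in the given registers -/
  | report (r : EdgeRecord (Fin k))
  | halt

/-- A configuration: program counter, registers, and the output written so far. -/
structure Config (k : ℕ) where
  pc : ℕ
  reg : Fin k → ℤ
  out : List (EdgeRecord ℤ)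

/-- All registers contain `0` at the start. -/
def Config.init (k : ℕ) : Config k := ⟨0, fun _ => 0, []⟩

/-- Write `v` to register `d` and go to the next instruction. A number that does not fit into a
word, that is, one of absolute value above `M`, cannot be written: the machine crashes. -/
def Config.store {k : ℕ} (M : ℕ) (c : Config k) (d : Fin k) (v : ℤ) : Option (Config k) :=
  if |v| ≤ (M : ℤ) then some ⟨c.pc + 1, Function.update c.reg d v, c.out⟩ else none

/-- Read entry `i` of an array of length `n`; there is no value if `i` is out of range. -/
def readArray {n : ℕ} (f : Fin n → ℤ) (i : ℤ) : Option ℤ :=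
  if h : i.toNat < n then (if 0 ≤ i then some (f ⟨i.toNat, h⟩) else none) else none

/-- Execute one instruction, with words that hold the integers of absolute value at most `M`. -/
def Instr.exec {k n : ℕ} (M : ℕ) (P : Sites n) (c : Config k) : Instr k → Option (Config k)
  | const d v => c.store M d v
  | copy d a => c.store M d (c.reg a)
  | arith op d a b => c.store M d (op.eval (c.reg a) (c.reg b))
  | size d => c.store M d n
  | loadX d a => (readArray P.x (c.reg a)).bind (c.store M d)
  | loadY d a => (readArray P.y (c.reg a)).bind (c.store M d)
  | jump t => some ⟨t, c.reg, c.out⟩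
  | jumpLt a b t => some ⟨if c.reg a < c.reg b then t else c.pc + 1, c.reg, c.out⟩
  | jumpEq a b t => some ⟨if c.reg a = c.reg b then t else c.pc + 1, c.reg, c.out⟩
  | report r => some ⟨c.pc + 1, c.reg, c.out ++ [r.map c.reg]⟩
  | halt => none

/-- One step of the machine; there is none after `halt` and after a crash. -/
def step {k n : ℕ} (prog : List (Instr k)) (M : ℕ) (P : Sites n) (c : Config k) :
    Option (Config k) :=
  (prog[c.pc]?).bind (Instr.exec M P c)

/-- The configuration after exactly `t` steps, if there is one. -/
def runSteps {k n : ℕ} (prog : List (Instr k)) (M : ℕ) (P : Sites n) : ℕ → Option (Config k)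
  | 0 => some (Config.init k)
  | t + 1 => (runSteps prog M P t).bind (step prog M P)

/-- On input `P`, with words that hold the integers of absolute value at most `M`, the program
reaches a `halt` instruction without a crash after at most `T` steps, and its output is then
`out`. -/
def HaltsWithin {k n : ℕ} (prog : List (Instr k)) (M : ℕ) (P : Sites n) (T : ℕ)
    (out : List (EdgeRecord ℤ)) : Prop :=
  ∃ t ≤ T, ∃ c : Config k,
    runSteps prog M P t = some c ∧ prog[c.pc]? = some Instr.halt ∧ c.out = out

/-! ### What it means to report all edges -/

/-- The set of points described by a record: an open line segment between its two ends or, if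
`w₂ = 0`, the open halfline from the first end in direction `(x₂, y₂)`. -/
noncomputable def EdgeRecord.carrier (r : EdgeRecord ℤ) : Set Plane :=
  if r.w₂ = 0 then
    {z | ∃ t : ℝ, 0 < t ∧
      z = !₂[(r.x₁ : ℝ) / r.w₁, (r.y₁ : ℝ) / r.w₁] + t • !₂[(r.x₂ : ℝ), (r.y₂ : ℝ)]}
  else
    openSegment ℝ (!₂[(r.x₁ : ℝ) / r.w₁, (r.y₁ : ℝ) / r.w₁] : Plane)
      !₂[(r.x₂ : ℝ) / r.w₂, (r.y₂ : ℝ) / r.w₂]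

/-- The record describes the (non-empty) edge `edge i j` of its two sites `i ≠ j`. -/
def EdgeRecord.Describes {n : ℕ} (edge : Fin n → Fin n → Set Plane) (r : EdgeRecord ℤ) : Prop :=
  ∃ i j : Fin n, i ≠ j ∧ r.site₁ = (i : ℕ) ∧ r.site₂ = (j : ℕ) ∧ 0 < r.w₁ ∧ 0 ≤ r.w₂ ∧
    (edge i j).Nonempty ∧ r.carrier = edge i j

/-- The output consists of correct descriptions of edges, contains every edge, and contains no edge
twice. -/
def ReportsEachEdgeOnce {n : ℕ} (edge : Fin n → Fin n → Set Plane)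
    (out : List (EdgeRecord ℤ)) : Prop :=
  (∀ r ∈ out, r.Describes edge) ∧
  (∀ i j : Fin n, i ≠ j → (edge i j).Nonempty → ∃ r ∈ out, r.carrier = edge i j) ∧
  (out.map EdgeRecord.carrier).Nodup

end VoronoiRAM

namespace VoronoiRAM

/-! Parametrise the bisector of the sites `i` and `j` by the displacement `τ` from their midpoint.
The difference of the squared distances to `k` and to `i` is then the affine function `num - τ *
det` (`sq_bis`). So `i` and `j` have an edge iff a system of strict linear inequalities in the
single unknown `τ` is solvable. The sites on one side of the line through `i` and `j` bound `τ` from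
above, those on the other side from below, and one scan per side finds the tightest bound
(`feasible_iff`, `isEdge_iff_of_ends`). The sign `σ = ±1` turns the inequalities around, so both
diagrams are treated at once.

The site `k` that gives the tightest bound on one side is where an existing edge ends, in a vertex
of the cells of `i`, `j`, `k` (`IsEnd.vertex`). The edge for `i` and `k` starts there too
(`Vertex.isEdge`), and no edge of the cell of `i` lies between the two in angular order
(`Vertex.not_isEdge_between`). Thus a scan also finds the next edge of the cell, and the boundary is
walked in the manner of gift wrapping, with a few site indices as the only memory. Orientation tests
order directions linearly only within a half-plane, so the walk starts twice from a first edge, once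
in each direction, and stops on leaving the half-plane. The first edge belongs to the nearest
neighbour of `i`, or, in the farthest-site diagram, to the site extreme in angle as seen from `i`.
In the latter diagram a cell may have no edges; then the candidate fails the edge test, and this
failure is conclusive. Each edge is met from both of its cells and is reported from the one with the
smaller index.

A scan costs `O(n)`, and there are `O(1)` scans per site and per met edge, so it remains to see that
there are `O(n)` edges. In place of Euler's formula, `sum_card_neighbors_le` charges every vertex to
the middle one of its three sites in a generic direction; a site is charged at most twice, because
such a vertex is extreme in its cell in the orthogonal direction (`Vertex.unique`).

The algorithm is written in a small structured language with a cost semantics and is compiled to the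
machine (`Exec.leads`). All expressions are fixed polynomials in coordinates and indices, so their
values are bounded by a fixed power of `n`. -/

/-! ### A structured language over site indices -/

/-- Integer expressions over variables that hold site indices. -/
inductive Expr where
  | const (v : ℤ)
  | idx (x : ℕ)
  | X (x : ℕ)
  | Y (x : ℕ)
  | add (a b : Expr)
  | sub (a b : Expr)
  | mul (a b : Expr)

namespace Expr

def eval {n : ℕ} (P : Sites n) (s : ℕ → Fin n) : Expr → ℤ
  | const v => v
  | idx x => (s x : ℕ)
  | X x => P.x (s x)
  | Y x => P.y (s x)
  | add a b => a.eval P s + b.eval P s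
  | sub a b => a.eval P s - b.eval P s
  | mul a b => a.eval P s * b.eval P s

/-- Bounds the variables, the code length, the stack depth and the magnitude of an expression. -/
def weight : Expr → ℕ
  | const v => v.natAbs + 1
  | idx x => x + 1
  | X x => x + 1
  | Y x => x + 1
  | add a b => a.weight + b.weight + 1
  | sub a b => a.weight + b.weight + 1
  | mul a b => a.weight + b.weight + 1

def len : Expr → ℕ
  | const _ => 1
  | idx _ => 1
  | X _ => 1
  | Y _ => 1
  | add a b => a.len + b.len + 1
  | sub a b => a.len + b.len + 1
  | mul a b => a.len + b.len + 1

theorem len_le_weight (e : Expr) : e.len ≤ e.weight := by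
  induction e <;> simp only [len, weight] <;> omega

theorem one_le_weight (e : Expr) : 1 ≤ e.weight := by
  cases e <;> simp only [weight] <;> omega

/-- Evaluates an expression into register `d`, with the registers above `d` as a stack. -/
def code (K : ℕ) : Expr → ℕ → List (Instr (K + 1))
  | const v, d => [.const (Fin.ofNat _ d) v]
  | idx x, d => [.copy (Fin.ofNat _ d) (Fin.ofNat _ x)]
  | X x, d => [.loadX (Fin.ofNat _ d) (Fin.ofNat _ x)]
  | Y x, d => [.loadY (Fin.ofNat _ d) (Fin.ofNat _ x)]
  | add a b, d => a.code K d ++ (b.code K (d + 1) ++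
      [.arith .add (Fin.ofNat _ d) (Fin.ofNat _ d) (Fin.ofNat _ (d + 1))])
  | sub a b, d => a.code K d ++ (b.code K (d + 1) ++
      [.arith .sub (Fin.ofNat _ d) (Fin.ofNat _ d) (Fin.ofNat _ (d + 1))])
  | mul a b, d => a.code K d ++ (b.code K (d + 1) ++
      [.arith .mul (Fin.ofNat _ d) (Fin.ofNat _ d) (Fin.ofNat _ (d + 1))])

theorem length_code (K : ℕ) (e : Expr) (d : ℕ) : (e.code K d).length = e.len := by
  induction e generalizing d <;> simp_all [code, len] <;> omega

/-- Products add exponents. Since `2 ≤ B`, one further factor `B` absorbs the sum of two terms,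
which is why every operation raises the weight by one. -/
theorem abs_eval_le {n : ℕ} {P : Sites n} {B : ℕ} (hB : 2 ≤ B) (hn : n ≤ B)
    (hx : ∀ i, |P.x i| ≤ (B : ℤ)) (hy : ∀ i, |P.y i| ≤ (B : ℤ)) (s : ℕ → Fin n) (e : Expr) :
    |e.eval P s| ≤ (B : ℤ) ^ e.weight := by
  have hB2 : (2 : ℤ) ≤ B := by exact_mod_cast hB
  have h1 : ∀ m : ℕ, (B : ℤ) ≤ (B : ℤ) ^ (m + 1) := fun m =>
    le_self_pow₀ (by omega) (by omega)
  have key : ∀ a b : ℕ, (B : ℤ) ^ a + (B : ℤ) ^ b ≤ (B : ℤ) ^ (a + b + 1) := by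
    intro a b
    have ha : (B : ℤ) ^ a ≤ (B : ℤ) ^ (a + b) := pow_le_pow_right₀ (by omega) (by omega)
    have hb : (B : ℤ) ^ b ≤ (B : ℤ) ^ (a + b) := pow_le_pow_right₀ (by omega) (by omega)
    have : (0 : ℤ) ≤ (B : ℤ) ^ (a + b) := by positivity
    rw [pow_succ]
    nlinarith
  induction e with
  | const v =>
    have h2 : v.natAbs < B ^ (v.natAbs + 1) :=
      lt_of_lt_of_le (Nat.lt_pow_self (by omega)) (Nat.pow_le_pow_right (by omega) (by omega))
    simp only [eval, weight, Int.abs_eq_natAbs]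
    exact_mod_cast h2.le
  | idx x =>
    have : ((s x : ℕ) : ℤ) ≤ B := by exact_mod_cast (s x).2.le.trans hn
    simp only [eval, weight]
    rw [abs_of_nonneg (by positivity)]
    exact this.trans (h1 _)
  | X x => exact (hx _).trans (h1 _)
  | Y x => exact (hy _).trans (h1 _)
  | add a b iha ihb =>
    exact (abs_add_le _ _).trans ((add_le_add iha ihb).trans (key _ _))
  | sub a b iha ihb =>
    exact (abs_sub _ _).trans ((add_le_add iha ihb).trans (key _ _))
  | mul a b iha ihb =>
    simp only [eval, weight, abs_mul]
    refine (mul_le_mul iha ihb (abs_nonneg _) (by positivity)).trans ?_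
    rw [← pow_add]
    exact pow_le_pow_right₀ (by omega) (by omega)

end Expr

/-- Commands; a test of an expression `e` asks whether `0 < e`. -/
inductive Cmd where
  | skip
  | copy (x y : ℕ)
  | report (r : EdgeRecord Expr)
  | seq (a b : Cmd)
  | ite (e : Expr) (a b : Cmd)
  | loop (e : Expr) (a : Cmd)
  /-- run `a` for all values of the variable `x` -/
  | all (x : ℕ) (a : Cmd)

/-- Values of the variables, and the output. -/
structure Store (n : ℕ) where
  var : ℕ → Fin n
  out : List (EdgeRecord ℤ)

def Store.set {n : ℕ} (s : Store n) (x : ℕ) (i : Fin n) : Store n :=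
  ⟨Function.update s.var x i, s.out⟩

/-- `Exec P c s s' t`: the command `c` leads from `s` to `s'` at cost `t`. -/
inductive Exec {n : ℕ} (P : Sites n) : Cmd → Store n → Store n → ℕ → Prop
  | skip (s) : Exec P .skip s s 0
  | copy (x y s) : Exec P (.copy x y) s (s.set x (s.var y)) 1
  | report (r s) : Exec P (.report r) s ⟨s.var, s.out ++ [r.map (Expr.eval P s.var)]⟩ 1
  | seq {a b s s' s'' t t'} : Exec P a s s' t → Exec P b s' s'' t' →
      Exec P (.seq a b) s s'' (t + t')
  | ite_pos {e a b s s' t} : 0 < e.eval P s.var → Exec P a s s' t →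
      Exec P (.ite e a b) s s' (t + 1)
  | ite_neg {e a b s s' t} : ¬ 0 < e.eval P s.var → Exec P b s s' t →
      Exec P (.ite e a b) s s' (t + 1)
  | loop_done {e a s} : ¬ 0 < e.eval P s.var → Exec P (.loop e a) s s 1
  | loop_step {e a s s' s'' t t'} : 0 < e.eval P s.var → Exec P a s s' t →
      Exec P (.loop e a) s' s'' t' → Exec P (.loop e a) s s'' (t + t' + 1)
  | all {x a} (S : ℕ → Store n) (t : ℕ → ℕ) (z : Fin n) (hz : (z : ℕ) = 0)
      (h : ∀ i : Fin n, Exec P a ((S i).set x i) (S (i + 1)) (t i))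
      (hx : ∀ i : Fin n, (S (i + 1)).var x = i) :
      Exec P (.all x a) (S 0) ((S n).set x z) (∑ i ∈ Finset.range n, (t i + 1) + 1)

/-! ### Compilation -/

def EdgeRecord.toList {α : Type} (r : EdgeRecord α) : List α :=
  [r.site₁, r.site₂, r.x₁, r.y₁, r.w₁, r.x₂, r.y₂, r.w₂]

def codeList (K : ℕ) : List Expr → ℕ → List (Instr (K + 1))
  | [], _ => []
  | e :: l, d => e.code K d ++ codeList K l (d + 1)

namespace Cmd

/-- A single number exceeding every variable in use and bounding the weight of every expression that
occurs. It fixes the number of variable registers, the stack depth and the exponent in the word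
size. -/
def weight : Cmd → ℕ
  | skip => 0
  | copy x y => x + y + 1
  | report r => (r.toList.map Expr.weight).sum
  | seq a b => a.weight + b.weight
  | ite e a b => e.weight + a.weight + b.weight
  | loop e a => e.weight + a.weight
  | all x a => x + 1 + a.weight

/-- Has to be the exact length of the code, since the jump targets are computed from it. -/
def len : Cmd → ℕ
  | skip => 0
  | copy _ _ => 1
  | report r => (r.toList.map Expr.len).sum + 1
  | seq a b => a.len + b.len
  | ite e a b => e.len + b.len + a.len + 3
  | loop e a => e.len + a.len + 4
  | all _ a => a.len + 8

/-- The code of a command at address `pc`; the variables are in the registers below `W`. -/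
def code (K W : ℕ) : Cmd → ℕ → List (Instr (K + 1))
  | skip, _ => []
  | copy x y, _ => [.copy (Fin.ofNat _ x) (Fin.ofNat _ y)]
  | report r, _ => codeList K r.toList W ++
      [.report ⟨Fin.ofNat _ W, Fin.ofNat _ (W + 1), Fin.ofNat _ (W + 2), Fin.ofNat _ (W + 3),
        Fin.ofNat _ (W + 4), Fin.ofNat _ (W + 5), Fin.ofNat _ (W + 6), Fin.ofNat _ (W + 7)⟩]
  | seq a b, pc => a.code K W pc ++ b.code K W (pc + a.len)
  | ite e a b, pc => e.code K W ++ ([.const (Fin.ofNat _ (W + 1)) 0,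
        .jumpLt (Fin.ofNat _ (W + 1)) (Fin.ofNat _ W) (pc + e.len + b.len + 3)] ++
      (b.code K W (pc + e.len + 2) ++ ([.jump (pc + e.len + b.len + a.len + 3)] ++
        a.code K W (pc + e.len + b.len + 3))))
  | loop e a, pc => e.code K W ++ ([.const (Fin.ofNat _ (W + 1)) 0,
        .jumpLt (Fin.ofNat _ (W + 1)) (Fin.ofNat _ W) (pc + e.len + 3),
        .jump (pc + e.len + a.len + 4)] ++ (a.code K W (pc + e.len + 3) ++ [.jump pc]))
  | all x a, pc => [.const (Fin.ofNat _ x) 0, .size (Fin.ofNat _ W),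
        .jumpLt (Fin.ofNat _ x) (Fin.ofNat _ W) (pc + 4), .jump (pc + a.len + 7)] ++
      (a.code K W (pc + 4) ++ [.const (Fin.ofNat _ W) 1,
        .arith .add (Fin.ofNat _ x) (Fin.ofNat _ x) (Fin.ofNat _ W), .jump (pc + 1),
        .const (Fin.ofNat _ x) 0])

end Cmd

/-! ### Correctness of the compilation -/

section Machine

variable {k n : ℕ} (prog : List (Instr k)) (M : ℕ) (P : Sites n)

/-- The program contains the code `l` at address `pc`. -/
def CodeAt (prog : List (Instr k)) : ℕ → List (Instr k) → Prop
  | _, [] => True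
  | pc, i :: l => prog[pc]? = some i ∧ CodeAt prog (pc + 1) l

theorem codeAt_append {pc : ℕ} {l₁ l₂ : List (Instr k)} :
    CodeAt prog pc (l₁ ++ l₂) ↔ CodeAt prog pc l₁ ∧ CodeAt prog (pc + l₁.length) l₂ := by
  induction l₁ generalizing pc with
  | nil => simp [CodeAt]
  | cons i l ih => simp [CodeAt, ih, and_assoc, Nat.add_assoc, Nat.add_comm 1]

theorem codeAt_self (l₁ l₂ : List (Instr k)) : CodeAt (l₁ ++ l₂) l₁.length l₂ := by
  induction l₂ generalizing l₁ with
  | nil => trivial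
  | cons i l ih =>
    refine ⟨by simp, ?_⟩
    simpa using ih (l₁ ++ [i])

/-- Unlike `runSteps`, this starts anywhere, so that runs can be concatenated. -/
def runFrom : ℕ → Config k → Option (Config k)
  | 0, c => some c
  | t + 1, c => (runFrom t c).bind (step prog M P)

theorem runFrom_add (a b : ℕ) (c : Config k) :
    runFrom prog M P (a + b) c = (runFrom prog M P a c).bind (runFrom prog M P b) := by
  induction b with
  | zero => simp [runFrom]
  | succ b ih =>
    rw [← Nat.add_assoc, runFrom, ih, Option.bind_assoc]
    rfl

theorem runSteps_eq_runFrom (t : ℕ) :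
    runSteps prog M P t = runFrom prog M P t (Config.init k) := by
  induction t with
  | zero => rfl
  | succ t ih => rw [runSteps, runFrom, ih]

/-- The machine gets from `c` to `c'` in at most `T` steps. -/
def Leads (T : ℕ) (c c' : Config k) : Prop := ∃ t ≤ T, runFrom prog M P t c = some c'

variable {prog M P}

theorem Leads.refl (c : Config k) : Leads prog M P 0 c c := ⟨0, le_rfl, rfl⟩

theorem Leads.trans {T T' : ℕ} {c c' c'' : Config k} (h : Leads prog M P T c c')
    (h' : Leads prog M P T' c' c'') : Leads prog M P (T + T') c c'' := by
  obtain ⟨t, ht, h⟩ := h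
  obtain ⟨t', ht', h'⟩ := h'
  exact ⟨t + t', by omega, by rw [runFrom_add, h, Option.bind_some, h']⟩

theorem Leads.mono {T T' : ℕ} {c c' : Config k} (h : Leads prog M P T c c') (hT : T ≤ T') :
    Leads prog M P T' c c' := by
  obtain ⟨t, ht, h⟩ := h
  exact ⟨t, ht.trans hT, h⟩

theorem Leads.of_exec {c c' : Config k} {i : Instr k} (hi : prog[c.pc]? = some i)
    (h : i.exec M P c = some c') : Leads prog M P 1 c c' :=
  ⟨1, le_rfl, by simp [runFrom, step, hi, h]⟩

end Machine

theorem ofNat_ne_ofNat {K a b : ℕ} (ha : a ≤ K) (hb : b ≤ K) (hab : a ≠ b) :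
    Fin.ofNat (K + 1) a ≠ Fin.ofNat (K + 1) b := by
  intro h
  have := congrArg Fin.val h
  simp only [Fin.val_ofNat] at this
  rw [Nat.mod_eq_of_lt (by omega), Nat.mod_eq_of_lt (by omega)] at this
  exact hab this

theorem readArray_val {n : ℕ} (f : Fin n → ℤ) (i : Fin n) :
    readArray f ((i : ℕ) : ℤ) = some (f i) := by
  simp [readArray]

/-- The registers below `W` hold the variables. -/
def Holds {K n : ℕ} (W : ℕ) (reg : Fin (K + 1) → ℤ) (v : ℕ → Fin n) : Prop :=
  ∀ x < W, reg (Fin.ofNat _ x) = ((v x : ℕ) : ℤ)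

/-- The bounds under which words of absolute value at most `M` suffice for all expressions of
weight at most `W`. -/
structure WordBounds {n : ℕ} (P : Sites n) (B W M : ℕ) : Prop where
  two_le : 2 ≤ B
  size_le : n ≤ B
  x_le : ∀ i, |P.x i| ≤ (B : ℤ)
  y_le : ∀ i, |P.y i| ≤ (B : ℤ)
  pow_le : B ^ W ≤ M

/-! ### Simulation of expressions -/

section Simulation

variable {n K W M B : ℕ} {P : Sites n} {prog : List (Instr (K + 1))}

theorem Config.store_of_le {k : ℕ} {c : Config k} {d : Fin k} {v : ℤ} (h : |v| ≤ (M : ℤ)) :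
    c.store M d v = some ⟨c.pc + 1, Function.update c.reg d v, c.out⟩ := if_pos h

theorem WordBounds.abs_eval_le (hP : WordBounds P B W M) (v : ℕ → Fin n) {e : Expr}
    (he : e.weight ≤ W) : |e.eval P v| ≤ (M : ℤ) := by
  refine (Expr.abs_eval_le hP.two_le hP.size_le hP.x_le hP.y_le v e).trans ?_
  have : B ^ e.weight ≤ M :=
    (Nat.pow_le_pow_right (by have := hP.two_le; omega) he).trans hP.pow_le
  exact_mod_cast this

theorem WordBounds.size_le_word (hP : WordBounds P B W M) (hW : 1 ≤ W) : (n : ℤ) ≤ M := by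
  have : B ≤ B ^ W := Nat.le_self_pow (by omega) B
  have := hP.size_le
  have := hP.pow_le
  have : n ≤ M := by omega
  exact_mod_cast this

theorem WordBounds.one_le_word (hP : WordBounds P B W M) : (1 : ℤ) ≤ M := by
  have h1 : 1 ≤ B ^ W := Nat.one_le_pow _ _ (by have := hP.two_le; omega)
  have := hP.pow_le
  have : 1 ≤ M := by omega
  exact_mod_cast this

/-- Besides the value, the induction needs that all registers below `d` survive: these are the
variables and the operands already on the stack. -/
theorem Expr.leads_code (hP : WordBounds P B W M) (v : ℕ → Fin n) (e : Expr)
    (he : e.weight ≤ W) (d : ℕ) (hd : W ≤ d) (hK : d + e.weight ≤ K) (c : Config (K + 1))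
    (hc : CodeAt prog c.pc (e.code K d)) (hv : Holds W c.reg v) :
    ∃ reg, Leads prog M P e.len c ⟨c.pc + e.len, reg, c.out⟩ ∧
      reg (Fin.ofNat _ d) = e.eval P v ∧
      ∀ x < d, reg (Fin.ofNat _ x) = c.reg (Fin.ofNat _ x) := by
  have hupd : ∀ (r : Fin (K + 1) → ℤ) (w : ℤ) (d' x : ℕ), d' ≤ K → x < d' →
      Function.update r (Fin.ofNat _ d') w (Fin.ofNat _ x) = r (Fin.ofNat _ x) :=
    fun r w d' x h1 h2 => Function.update_of_ne (ofNat_ne_ofNat (by omega) h1 (by omega)) _ _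
  -- The three binary operations differ only in `o`. The induction hypotheses for the operands enter
  -- as premises, the second one with the stack starting at `d + 1`.
  have hbin : ∀ (d : ℕ) (c : Config (K + 1)) (a b : Expr) (o : ArithOp) (e : Expr), W ≤ d →
      Holds W c.reg v →
      (∀ (c : Config (K + 1)), CodeAt prog c.pc (a.code K d) → Holds W c.reg v →
        ∃ reg, Leads prog M P a.len c ⟨c.pc + a.len, reg, c.out⟩ ∧
          reg (Fin.ofNat _ d) = a.eval P v ∧
          ∀ x < d, reg (Fin.ofNat _ x) = c.reg (Fin.ofNat _ x)) →
      (∀ (c : Config (K + 1)), CodeAt prog c.pc (b.code K (d + 1)) → Holds W c.reg v →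
        ∃ reg, Leads prog M P b.len c ⟨c.pc + b.len, reg, c.out⟩ ∧
          reg (Fin.ofNat _ (d + 1)) = b.eval P v ∧
          ∀ x < d + 1, reg (Fin.ofNat _ x) = c.reg (Fin.ofNat _ x)) →
      e.code K d = a.code K d ++ (b.code K (d + 1) ++
        [.arith o (Fin.ofNat _ d) (Fin.ofNat _ d) (Fin.ofNat _ (d + 1))]) →
      e.len = a.len + b.len + 1 → e.weight ≤ W → d + 1 ≤ K →
      e.eval P v = o.eval (a.eval P v) (b.eval P v) →
      CodeAt prog c.pc (e.code K d) →
      ∃ reg, Leads prog M P e.len c ⟨c.pc + e.len, reg, c.out⟩ ∧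
        reg (Fin.ofNat _ d) = e.eval P v ∧
        ∀ x < d, reg (Fin.ofNat _ x) = c.reg (Fin.ofNat _ x) := by
    intro d c a b o e hd hv iha ihb hcode hlen hw hdK hev hc
    rw [hcode, codeAt_append, codeAt_append, Expr.length_code, Expr.length_code] at hc
    obtain ⟨ha, hb, ho, -⟩ := hc
    obtain ⟨r₁, l₁, e₁, f₁⟩ := iha c ha hv
    obtain ⟨r₂, l₂, e₂, f₂⟩ := ihb ⟨c.pc + a.len, r₁, c.out⟩ hb
      (fun x hx => (f₁ x (by omega)).trans (hv x hx))
    refine ⟨Function.update r₂ (Fin.ofNat _ d) (e.eval P v), ?_, by simp, fun x hx => ?_⟩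
    · rw [hlen]
      refine (l₁.trans l₂).trans (Leads.of_exec ho ?_)
      have h3 : o.eval (r₂ (Fin.ofNat _ d)) (r₂ (Fin.ofNat _ (d + 1))) = e.eval P v := by
        rw [e₂, f₂ d (by omega), hev]
        simp only [e₁]
      simp only [Instr.exec]
      rw [h3, Config.store_of_le (hP.abs_eval_le v hw)]
      simp [Nat.add_assoc]
    · rw [hupd _ _ _ _ (by omega) hx, f₂ x (by omega)]
      exact f₁ x hx
  have hone : ∀ (d : ℕ) (c : Config (K + 1)) (i : Instr (K + 1)) (w : ℤ), d ≤ K → prog[c.pc]? = some i →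
      i.exec M P c = c.store M (Fin.ofNat _ d) w → |w| ≤ (M : ℤ) →
      ∃ reg, Leads prog M P 1 c ⟨c.pc + 1, reg, c.out⟩ ∧ reg (Fin.ofNat _ d) = w ∧
        ∀ x < d, reg (Fin.ofNat _ x) = c.reg (Fin.ofNat _ x) := by
    intro d c i w hdK hi hex hw
    refine ⟨Function.update c.reg (Fin.ofNat _ d) w, Leads.of_exec hi ?_, by simp,
      fun x hx => hupd _ _ _ _ hdK hx⟩
    rw [hex, Config.store_of_le hw]
  induction e generalizing d c with
  | const u => exact hone d c _ _ (by omega) hc.1 rfl (hP.abs_eval_le v he)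
  | idx x =>
    simp only [Expr.weight] at he
    refine hone d c _ _ (by omega) hc.1 ?_ (hP.abs_eval_le v (e := .idx x) he)
    simp only [Instr.exec, hv x (by omega), Expr.eval]
  | X x =>
    simp only [Expr.weight] at he
    refine hone d c _ _ (by omega) hc.1 ?_ (hP.abs_eval_le v (e := .X x) he)
    simp only [Instr.exec, hv x (by omega), Expr.eval, readArray_val, Option.bind_some]
  | Y x =>
    simp only [Expr.weight] at he
    refine hone d c _ _ (by omega) hc.1 ?_ (hP.abs_eval_le v (e := .Y x) he)
    simp only [Instr.exec, hv x (by omega), Expr.eval, readArray_val, Option.bind_some]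
  | add a b iha ihb =>
    simp only [Expr.weight] at he hK
    have h1 := b.one_le_weight
    have h2 := a.one_le_weight
    exact hbin d c a b .add (.add a b) hd hv
      (fun c hc hv => iha (by omega) d hd (by omega) c hc hv)
      (fun c hc hv => ihb (by omega) (d + 1) (by omega) (by omega) c hc hv) rfl rfl
      (by simp only [Expr.weight]; omega) (by omega) rfl hc
  | sub a b iha ihb =>
    simp only [Expr.weight] at he hK
    have h1 := b.one_le_weight
    have h2 := a.one_le_weight
    exact hbin d c a b .sub (.sub a b) hd hv
      (fun c hc hv => iha (by omega) d hd (by omega) c hc hv)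
      (fun c hc hv => ihb (by omega) (d + 1) (by omega) (by omega) c hc hv) rfl rfl
      (by simp only [Expr.weight]; omega) (by omega) rfl hc
  | mul a b iha ihb =>
    simp only [Expr.weight] at he hK
    have h1 := b.one_le_weight
    have h2 := a.one_le_weight
    exact hbin d c a b .mul (.mul a b) hd hv
      (fun c hc hv => iha (by omega) d hd (by omega) c hc hv)
      (fun c hc hv => ihb (by omega) (d + 1) (by omega) (by omega) c hc hv) rfl rfl
      (by simp only [Expr.weight]; omega) (by omega) rfl hc

end Simulation

/-! ### Simulation of commands -/

section Simulation

variable {n K W M B : ℕ} {P : Sites n} {prog : List (Instr (K + 1))}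

theorem Cmd.length_code_report (r : EdgeRecord Expr) (d : ℕ) :
    (codeList K r.toList d).length = (r.toList.map Expr.len).sum := by
  induction r.toList generalizing d with
  | nil => rfl
  | cons e l ih => simp [codeList, Expr.length_code, ih]

theorem Cmd.length_code (a : Cmd) (pc : ℕ) : (a.code K W pc).length = a.len := by
  induction a generalizing pc with
  | report r => simp [code, len, length_code_report]
  | _ => simp_all [code, len, Expr.length_code] <;> omega

theorem leads_codeList (hP : WordBounds P B W M) (v : ℕ → Fin n) (l : List Expr)
    (hl : ∀ e ∈ l, e.weight ≤ W) (d : ℕ) (hd : W ≤ d) (hK : d + l.length + W ≤ K)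
    (c : Config (K + 1)) (hc : CodeAt prog c.pc (codeList K l d)) (hv : Holds W c.reg v) :
    ∃ reg, Leads prog M P (l.map Expr.len).sum c ⟨c.pc + (l.map Expr.len).sum, reg, c.out⟩ ∧
      (∀ m (h : m < l.length), reg (Fin.ofNat _ (d + m)) = l[m].eval P v) ∧
      ∀ x < d, reg (Fin.ofNat _ x) = c.reg (Fin.ofNat _ x) := by
  induction l generalizing d c with
  | nil => exact ⟨c.reg, Leads.refl c, by simp, fun _ _ => rfl⟩
  | cons e l ih =>
    rw [codeList, codeAt_append, Expr.length_code] at hc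
    simp only [List.length_cons] at hK
    have hw := hl e (by simp)
    obtain ⟨r₁, l₁, e₁, f₁⟩ := e.leads_code hP v hw d hd (by omega) c hc.1 hv
    obtain ⟨r₂, l₂, e₂, f₂⟩ := ih (fun e he => hl e (by simp [he])) (d + 1) (by omega) (by omega)
      ⟨c.pc + e.len, r₁, c.out⟩ hc.2 (fun x hx => (f₁ x (by omega)).trans (hv x hx))
    refine ⟨r₂, ?_, fun m hm => ?_, fun x hx => (f₂ x (by omega)).trans (f₁ x hx)⟩
    · have := l₁.trans l₂
      simpa [Nat.add_assoc] using this
    · rcases m with _ | m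
      · exact (f₂ d (by omega)).trans e₁
      · have := e₂ m (by simpa using hm)
        simpa [Nat.add_assoc, Nat.add_comm 1 m] using this

theorem sum_map_len_le (l : List Expr) : (l.map Expr.len).sum ≤ (l.map Expr.weight).sum := by
  induction l with
  | nil => simp
  | cons e l ih => have := e.len_le_weight; simp only [List.map_cons, List.sum_cons]; omega

/-- Common to conditionals and loops: the value goes to register `W`, a zero to `W + 1`, and the two
are compared. The code of `e` has at most `W` instructions, hence the `W + 2`. -/
theorem leads_test (hP : WordBounds P B W M) (hK : 2 * W + 10 ≤ K) (v : ℕ → Fin n) (e : Expr)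
    (he : e.weight ≤ W) (q : ℕ) (c : Config (K + 1))
    (hc : CodeAt prog c.pc (e.code K W)) (h0 : prog[c.pc + e.len]? =
      some (.const (Fin.ofNat _ (W + 1)) 0))
    (h1 : prog[c.pc + e.len + 1]? = some (.jumpLt (Fin.ofNat _ (W + 1)) (Fin.ofNat _ W) q))
    (hv : Holds W c.reg v) :
    ∃ reg, Leads prog M P (W + 2) c
        ⟨if 0 < e.eval P v then q else c.pc + e.len + 2, reg, c.out⟩ ∧ Holds W reg v := by
  obtain ⟨r₁, l₁, e₁, f₁⟩ := e.leads_code hP v he W le_rfl (by omega) c hc hv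
  refine ⟨Function.update r₁ (Fin.ofNat _ (W + 1)) 0, ?_, fun x hx => ?_⟩
  · have hW := e.len_le_weight
    refine ((l₁.trans (Leads.of_exec (c' := ⟨c.pc + e.len + 1,
      Function.update r₁ (Fin.ofNat _ (W + 1)) 0, c.out⟩) h0 ?_)).trans
      (Leads.of_exec h1 ?_)).mono (by omega)
    · exact Config.store_of_le (by simp)
    · simp only [Instr.exec, Function.update_self,
        Function.update_of_ne (ofNat_ne_ofNat (K := K) (a := W) (b := W + 1) (by omega) (by omega)
          (by omega)), e₁]
  · rw [Function.update_of_ne (ofNat_ne_ofNat (by omega) (by omega) (by omega)), f₁ x hx]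
    exact hv x hx

theorem Holds.update {reg : Fin (K + 1) → ℤ} {v : ℕ → Fin n} (h : Holds W reg v) (hK : W ≤ K)
    {x : ℕ} (hx : x < W) (i : Fin n) :
    Holds W (Function.update reg (Fin.ofNat _ x) ((i : ℕ) : ℤ)) (Function.update v x i) := by
  intro y hy
  by_cases hxy : y = x
  · subst hxy; simp
  · rw [Function.update_of_ne hxy,
      Function.update_of_ne (ofNat_ne_ofNat (by omega) (by omega) hxy)]
    exact h y hy

/-- Compiled code simulates the command, with a constant number of steps per unit of cost. -/
theorem Exec.leads (hP : WordBounds P B W M) (hK : 2 * W + 10 ≤ K) {a : Cmd} {s s' : Store n}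
    {t : ℕ} (h : Exec P a s s' t) (ha : a.weight ≤ W) (c : Config (K + 1))
    (hc : CodeAt prog c.pc (a.code K W c.pc)) (hv : Holds W c.reg s.var) (ho : c.out = s.out) :
    ∃ reg, Leads prog M P ((W + 10) * t) c ⟨c.pc + a.len, reg, s'.out⟩ ∧
      Holds W reg s'.var := by
  induction h generalizing c with
  | skip s => exact ⟨c.reg, by rw [← ho]; exact Leads.refl c, hv⟩
  | copy x y s =>
    simp only [Cmd.weight] at ha
    refine ⟨Function.update c.reg (Fin.ofNat _ x) ((s.var y : ℕ) : ℤ),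
      (Leads.of_exec hc.1 ?_).mono (by omega), hv.update (by omega) (by omega) _⟩
    have hn : |((s.var y : ℕ) : ℤ)| ≤ (M : ℤ) := by
      have h1 := hP.size_le_word (by omega)
      have h2 := (s.var y).2
      rw [abs_of_nonneg (by positivity)]
      omega
    simp only [Instr.exec, hv y (by omega)]
    rw [Config.store_of_le hn, ho]
    rfl
  | report r s =>
    simp only [Cmd.weight] at ha
    simp only [Cmd.code] at hc
    rw [codeAt_append, Cmd.length_code_report] at hc
    have hw : ∀ e ∈ r.toList, e.weight ≤ W := fun e he =>
      (List.single_le_sum (by simp) _ (List.mem_map_of_mem he)).trans ha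
    obtain ⟨reg, l₁, e₁, f₁⟩ := leads_codeList hP s.var r.toList hw W le_rfl
      (by simp only [EdgeRecord.toList, List.length_cons, List.length_nil]; omega) c hc.1 hv
    have hs := (sum_map_len_le r.toList).trans ha
    refine ⟨reg, (l₁.trans (Leads.of_exec hc.2.1 ?_)).mono (by omega),
      fun x hx => (f₁ x hx).trans (hv x hx)⟩
    have g := fun m h => e₁ m h
    simp only [EdgeRecord.toList, List.length_cons, List.length_nil] at g
    have g0 := g 0 (by omega)
    have g1 := g 1 (by omega)
    have g2 := g 2 (by omega)
    have g3 := g 3 (by omega)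
    have g4 := g 4 (by omega)
    have g5 := g 5 (by omega)
    have g6 := g 6 (by omega)
    have g7 := g 7 (by omega)
    simp only [List.getElem_cons_zero, List.getElem_cons_succ, Nat.add_zero]
      at g0 g1 g2 g3 g4 g5 g6 g7
    simp only [Instr.exec, EdgeRecord.map, g0, g1, g2, g3, g4, g5, g6, g7, ho, Cmd.len,
      Nat.add_assoc]
  | seq _ _ ih₁ ih₂ =>
    simp only [Cmd.weight] at ha
    simp only [Cmd.code] at hc
    rw [codeAt_append, Cmd.length_code] at hc
    obtain ⟨r₁, l₁, f₁⟩ := ih₁ (by omega) c hc.1 hv ho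
    obtain ⟨r₂, l₂, f₂⟩ := ih₂ (by omega) ⟨_, r₁, _⟩ hc.2 f₁ rfl
    refine ⟨r₂, ?_, f₂⟩
    have := l₁.trans l₂
    simpa only [Cmd.len, Nat.mul_add, Nat.add_assoc] using this
  | @ite_pos e a b s s' t he _ ih =>
    simp only [Cmd.weight] at ha
    simp only [Cmd.code] at hc
    simp only [codeAt_append, Cmd.length_code, Expr.length_code] at hc
    obtain ⟨h1, ⟨h2, h3, -⟩, h4, h5, h6⟩ := hc
    obtain ⟨r₁, l₁, f₁⟩ := leads_test hP hK s.var e (by omega) _ c h1 h2 h3 hv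
    rw [if_pos he] at l₁
    obtain ⟨r₂, l₂, f₂⟩ := ih (by omega) ⟨_, r₁, c.out⟩
      (by
        have h : c.pc + e.len + 2 + b.len + 1 = c.pc + e.len + b.len + 3 := by omega
        exact h ▸ h6) f₁ ho
    refine ⟨r₂, ?_, f₂⟩
    have := (l₁.trans l₂).mono (T' := (W + 10) * (t + 1)) (by rw [Nat.mul_succ]; omega)
    convert this using 2
    simp only [Cmd.len]; omega
  | @ite_neg e a b s s' t he _ ih =>
    simp only [Cmd.weight] at ha
    simp only [Cmd.code] at hc
    simp only [codeAt_append, Cmd.length_code, Expr.length_code] at hc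
    obtain ⟨h1, ⟨h2, h3, -⟩, h4, ⟨h5, -⟩, h6⟩ := hc
    obtain ⟨r₁, l₁, f₁⟩ := leads_test hP hK s.var e (by omega) _ c h1 h2 h3 hv
    rw [if_neg he] at l₁
    obtain ⟨r₂, l₂, f₂⟩ := ih (by omega) ⟨_, r₁, c.out⟩ h4 f₁ ho
    refine ⟨r₂, ?_, f₂⟩
    refine ((l₁.trans l₂).trans (Leads.of_exec (i := .jump (c.pc + e.len + b.len + a.len + 3))
      ?_ ?_)).mono (by rw [Nat.mul_succ]; omega)
    · exact h5
    · simp only [Instr.exec, Cmd.len]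
      congr 2; omega
  | @loop_done e a s he =>
    simp only [Cmd.weight] at ha
    simp only [Cmd.code] at hc
    simp only [codeAt_append, Cmd.length_code, Expr.length_code] at hc
    obtain ⟨h1, ⟨h2, h3, h4, -⟩, -, -⟩ := hc
    obtain ⟨r₁, l₁, f₁⟩ := leads_test hP hK s.var e (by omega) _ c h1 h2 h3 hv
    rw [if_neg he] at l₁
    refine ⟨r₁, (l₁.trans (Leads.of_exec h4 ?_)).mono (by omega), f₁⟩
    simp only [Instr.exec, Cmd.len, ho]
    congr 2; omega
  | @loop_step e a s s' s'' t t' he _ _ ih₁ ih₂ =>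
    have hc0 := hc
    have ha0 := ha
    simp only [Cmd.weight] at ha
    simp only [Cmd.code] at hc
    simp only [codeAt_append, Cmd.length_code, Expr.length_code] at hc
    obtain ⟨h1, ⟨h2, h3, h4, -⟩, h5, h6, -⟩ := hc
    obtain ⟨r₁, l₁, f₁⟩ := leads_test hP hK s.var e (by omega) _ c h1 h2 h3 hv
    rw [if_pos he] at l₁
    obtain ⟨r₂, l₂, f₂⟩ := ih₁ (by omega) ⟨_, r₁, c.out⟩ h5 f₁ ho
    have l₃ : Leads prog M P 1 _ ⟨c.pc, r₂, s'.out⟩ := Leads.of_exec (M := M) (P := P)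
      (c := ⟨c.pc + e.len + 3 + a.len, r₂, s'.out⟩) (i := .jump c.pc)
      (by rw [← h6]; congr 1) rfl
    obtain ⟨r₄, l₄, f₄⟩ := ih₂ ha0 ⟨c.pc, r₂, s'.out⟩ hc0 f₂ rfl
    refine ⟨r₄, (((l₁.trans l₂).trans l₃).trans l₄).mono ?_, f₄⟩
    simp only [Nat.mul_add]; omega
  | @all x a S t z hz _ hx ih =>
    simp only [Cmd.weight] at ha
    simp only [Cmd.code] at hc
    simp only [codeAt_append, Cmd.length_code] at hc
    obtain ⟨⟨h1, h2, h3, h4, -⟩, h5, h6, h7, h8, h9, -⟩ := hc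
    simp only [List.length_cons, List.length_nil, Nat.add_assoc, Nat.reduceAdd]
      at h2 h3 h4 h5 h6 h7 h8 h9
    have hM := hP.size_le_word (by omega)
    have hM1 := hP.one_le_word
    -- Between rounds the counter register holds the number `j` itself, which for `j = n` is not a
    -- site index. Agreement with the store is therefore claimed only for the other variables.
    have key : ∀ j ≤ n, ∃ reg : Fin (K + 1) → ℤ,
        Leads prog M P (∑ i ∈ Finset.range j, (W + 10) * (t i + 1) + 1) c
          ⟨c.pc + 1, reg, (S j).out⟩ ∧ reg (Fin.ofNat _ x) = j ∧
        ∀ y < W, y ≠ x → reg (Fin.ofNat _ y) = (((S j).var y : ℕ) : ℤ) := by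
      intro j
      induction j with
      | zero =>
        refine fun _ => ⟨Function.update c.reg (Fin.ofNat _ x) 0, Leads.of_exec h1 ?_, by simp,
          fun y hy hyx => ?_⟩
        · rw [← ho]; exact Config.store_of_le (by simp)
        · rw [Function.update_of_ne (ofNat_ne_ofNat (by omega) (by omega) hyx)]
          exact hv y hy
      | succ j ihj =>
        intro hj
        obtain ⟨r₁, l₁, e₁, f₁⟩ := ihj (by omega)
        -- Register `W` is scratch space for the body, so the size is loaded anew in every round.
        let r₂ := Function.update r₁ (Fin.ofNat _ W) (n : ℤ)
        have l₂ : Leads prog M P 1 ⟨c.pc + 1, r₁, (S j).out⟩ ⟨c.pc + 2, r₂, (S j).out⟩ :=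
          Leads.of_exec h2 (Config.store_of_le (by rwa [abs_of_nonneg (by positivity)]))
        have hxW : r₂ (Fin.ofNat _ x) = j := by
          simp only [r₂]
          rw [Function.update_of_ne (ofNat_ne_ofNat (by omega) (by omega) (by omega)), e₁]
        have l₃ : Leads prog M P 1 ⟨c.pc + 2, r₂, (S j).out⟩ ⟨c.pc + 4, r₂, (S j).out⟩ := by
          refine Leads.of_exec h3 ?_
          simp only [Instr.exec, hxW, r₂, Function.update_self]
          rw [if_pos (by exact_mod_cast hj)]
        have hold : Holds W r₂ ((S j).set x ⟨j, hj⟩).var := by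
          intro y hy
          by_cases hyx : y = x
          · subst hyx; rw [hxW]; simp [Store.set]
          · simp only [Store.set, Function.update_of_ne hyx, r₂]
            rw [Function.update_of_ne (ofNat_ne_ofNat (by omega) (by omega) (by omega))]
            exact f₁ y hy hyx
        obtain ⟨r₃, l₄, f₃⟩ := ih ⟨j, hj⟩ (by omega) ⟨c.pc + 4, r₂, (S j).out⟩ h5 hold rfl
        let r₄ := Function.update r₃ (Fin.ofNat _ W) 1
        let r₅ := Function.update r₄ (Fin.ofNat _ x) ((j : ℤ) + 1)
        have l₅ : Leads prog M P 1 ⟨c.pc + 4 + a.len, r₃, (S (j + 1)).out⟩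
            ⟨c.pc + 4 + a.len + 1, r₄, (S (j + 1)).out⟩ :=
          Leads.of_exec (i := .const (Fin.ofNat _ W) 1) (by rw [← h6]; congr 1; dsimp only; omega)
            (Config.store_of_le (by simpa using hM1))
        have hr3 : r₃ (Fin.ofNat _ x) = j := by
          rw [f₃ x (by omega)]
          have := hx ⟨j, hj⟩
          simp only at this
          rw [this]
        have l₆ : Leads prog M P 1 ⟨c.pc + 4 + a.len + 1, r₄, (S (j + 1)).out⟩
            ⟨c.pc + 4 + a.len + 2, r₅, (S (j + 1)).out⟩ := by
          refine Leads.of_exec (by rw [← h7]; congr 1; dsimp only; omega) ?_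
          have h10 : ArithOp.add.eval (r₄ (Fin.ofNat _ x)) (r₄ (Fin.ofNat _ W)) = (j : ℤ) + 1 := by
            simp only [r₄, ArithOp.eval, Function.update_self]
            rw [Function.update_of_ne (ofNat_ne_ofNat (by omega) (by omega) (by omega)), hr3]
          simp only [Instr.exec]
          rw [h10]
          exact Config.store_of_le (by rw [abs_of_nonneg (by positivity)]; omega)
        have l₇ : Leads prog M P 1 ⟨c.pc + 4 + a.len + 2, r₅, (S (j + 1)).out⟩
            ⟨c.pc + 1, r₅, (S (j + 1)).out⟩ :=
          Leads.of_exec (by rw [← h8]; congr 1; dsimp only; omega) rfl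
        refine ⟨r₅, ((((((l₁.trans l₂).trans l₃).trans l₄).trans l₅).trans l₆).trans l₇).mono ?_,
          by simp [r₅], fun y hy hyx => ?_⟩
        · rw [Finset.sum_range_succ, Nat.mul_succ]; dsimp only; omega
        · simp only [r₅, r₄]
          rw [Function.update_of_ne (ofNat_ne_ofNat (by omega) (by omega) hyx),
            Function.update_of_ne (ofNat_ne_ofNat (by omega) (by omega) (by omega))]
          exact f₃ y hy
    -- The counter is now `n`; the last instruction of the code resets it to `0`, which makes it a
    -- valid index again.
    obtain ⟨r₁, l₁, e₁, f₁⟩ := key n le_rfl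
    let r₂ := Function.update r₁ (Fin.ofNat _ W) (n : ℤ)
    have l₂ : Leads prog M P 1 ⟨c.pc + 1, r₁, (S n).out⟩ ⟨c.pc + 2, r₂, (S n).out⟩ :=
      Leads.of_exec h2 (Config.store_of_le (by rwa [abs_of_nonneg (by positivity)]))
    have l₃ : Leads prog M P 1 ⟨c.pc + 2, r₂, (S n).out⟩ ⟨c.pc + 3, r₂, (S n).out⟩ := by
      refine Leads.of_exec h3 ?_
      simp only [Instr.exec, r₂, Function.update_self]
      rw [Function.update_of_ne (ofNat_ne_ofNat (by omega) (by omega) (by omega)), e₁,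
        if_neg (lt_irrefl _)]
    have l₄ : Leads prog M P 1 ⟨c.pc + 3, r₂, (S n).out⟩ ⟨c.pc + a.len + 7, r₂, (S n).out⟩ :=
      Leads.of_exec h4 rfl
    have l₅ : Leads prog M P 1 ⟨c.pc + a.len + 7, r₂, (S n).out⟩
        ⟨c.pc + a.len + 8, Function.update r₂ (Fin.ofNat _ x) 0, (S n).out⟩ :=
      Leads.of_exec (i := .const (Fin.ofNat _ x) 0) (by rw [← h9]; congr 1; dsimp only; omega)
        (Config.store_of_le (by simp))
    refine ⟨_, ((((l₁.trans l₂).trans l₃).trans l₄).trans l₅).mono ?_, ?_⟩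
    · rw [Nat.mul_succ, Finset.mul_sum]; omega
    · intro y hy
      by_cases hyx : y = x
      · subst hyx; simp [Store.set, hz]
      · simp only [Store.set, Function.update_of_ne hyx, r₂]
        rw [Function.update_of_ne (ofNat_ne_ofNat (by omega) (by omega) hyx),
          Function.update_of_ne (ofNat_ne_ofNat (by omega) (by omega) (by omega))]
        exact f₁ y hy hyx

end Simulation

/-- Every command compiles to a program. -/
theorem exists_program (a : Cmd) :
    ∃ (k : ℕ) (prog : List (Instr k)) (A : ℕ), ∀ b : ℕ, ∃ c : ℕ, ∀ (n : ℕ) (P : Sites n),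
      3 ≤ n → (∀ i, |P.x i| ≤ (n : ℤ) ^ b ∧ |P.y i| ≤ (n : ℤ) ^ b) →
      ∀ (z : Fin n) (s : Store n) (t : ℕ), (z : ℕ) = 0 → Exec P a ⟨fun _ => z, []⟩ s t →
        HaltsWithin prog (n ^ c) P (A * t) s.out := by
  let W := a.weight
  -- The eight fields of a record occupy the registers from `W` to `W + 7`, and evaluating the last
  -- of them needs a stack of depth at most `W`.
  let K := 2 * W + 10
  refine ⟨K + 1, a.code K W 0 ++ [.halt], W + 10, fun b => ⟨(b + 1) * W, ?_⟩⟩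
  intro n P hn hP z s t hz h
  have hb : (n : ℤ) ^ b ≤ ((n ^ (b + 1) : ℕ) : ℤ) := by
    exact_mod_cast Nat.pow_le_pow_right (by omega) (by omega)
  have hnB : n ≤ n ^ (b + 1) := Nat.le_self_pow (by omega) n
  -- The exponent `b + 1` instead of `b` makes the base bound `n` as well, even for `b = 0`.
  have hw : WordBounds P (n ^ (b + 1)) W (n ^ ((b + 1) * W)) :=
    ⟨by omega, hnB, fun i => (hP i).1.trans hb, fun i => (hP i).2.trans hb, by rw [pow_mul]⟩
  have hcode := ((codeAt_append _).1 (codeAt_self [] (a.code K W 0 ++ [.halt])))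
  obtain ⟨reg, ⟨t', ht', hr⟩, -⟩ := h.leads hw le_rfl le_rfl (Config.init (K + 1)) hcode.1
    (fun x _ => by simp [Config.init, hz]) rfl
  refine ⟨t', ht', _, by rw [runSteps_eq_runFrom]; exact hr, ?_, rfl⟩
  simp [Cmd.length_code, Config.init]


/-! ### Geometry of the diagrams -/

section Geometry

variable {n : ℕ} (P : Sites n)

/-- Twice the signed area of the triangle `i j k`. -/
def det (i j k : Fin n) : ℤ :=
  (P.x j - P.x i) * (P.y k - P.y i) - (P.y j - P.y i) * (P.x k - P.x i)

/-- The inner product of the vectors from `k` to `i` and to `j`. -/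
def num (i j k : Fin n) : ℤ :=
  (P.x k - P.x i) * (P.x k - P.x j) + (P.y k - P.y i) * (P.y k - P.y j)

/-- The squared distance of `(a, b)` from the site `i`. -/
def sq (i : Fin n) (a b : ℝ) : ℝ := (a - P.x i) ^ 2 + (b - P.y i) ^ 2

/-- The coordinates of the points of the bisector of `i` and `j`. -/
noncomputable def bisX (i j : Fin n) (τ : ℝ) : ℝ :=
  P.x i + (P.x j - P.x i) / 2 - τ / 2 * (P.y j - P.y i)

noncomputable def bisY (i j : Fin n) (τ : ℝ) : ℝ :=
  P.y i + (P.y j - P.y i) / 2 + τ / 2 * (P.x j - P.x i)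

/-- General position, in coordinates. -/
structure Generic : Prop where
  ne : ∀ i j, i ≠ j → P.x i ≠ P.x j ∨ P.y i ≠ P.y j
  det_ne : ∀ i j k, i ≠ j → i ≠ k → j ≠ k → det P i j k ≠ 0
  not_cocircular : ∀ i j k l a b, i ≠ j → i ≠ k → i ≠ l → j ≠ k → j ≠ l → k ≠ l →
    sq P j a b = sq P i a b → sq P k a b = sq P i a b → sq P l a b ≠ sq P i a b

/-- `(a, b)` is a point of the edge for `i` and `j`; here `σ = 1` for the nearest-site and `σ = -1`
for the farthest-site diagram. -/
def EdgePoint (σ : ℤ) (i j : Fin n) (a b : ℝ) : Prop :=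
  sq P j a b = sq P i a b ∧ ∀ k, k ≠ i → k ≠ j → 0 < (σ : ℝ) * (sq P k a b - sq P i a b)

def IsEdge (σ : ℤ) (i j : Fin n) : Prop := i ≠ j ∧ ∃ a b, EdgePoint P σ i j a b

/-- `(a, b)` is a vertex of the diagram, at which the cells of `i`, `j`, `k` meet. -/
structure Vertex (σ : ℤ) (i j k : Fin n) (a b : ℝ) : Prop where
  ij : i ≠ j
  ik : i ≠ k
  jk : j ≠ k
  sq_j : sq P j a b = sq P i a b
  sq_k : sq P k a b = sq P i a b
  pos : ∀ m, m ≠ i → m ≠ j → m ≠ k → 0 < (σ : ℝ) * (sq P m a b - sq P i a b)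

/-- Among the sites on the side `d` of the line from `i` to `j`, the site `k` bounds the edge for
`i` and `j` first. -/
def IsEnd (σ d : ℤ) (i j k : Fin n) : Prop :=
  0 < d * det P i j k ∧ ∀ m, 0 < d * det P i j m →
    ¬ 0 < σ * d * (num P i j k * det P i j m - num P i j m * det P i j k)

variable {P} {σ d : ℤ} {i j k l m : Fin n} {a b τ : ℝ}

/-- The quadratic terms cancel. Every site thus imposes one affine inequality in `τ`, whose slope
has the sign of the side of the line on which the site lies. -/
theorem sq_bis (i j k : Fin n) (τ : ℝ) :
    sq P k (bisX P i j τ) (bisY P i j τ) - sq P i (bisX P i j τ) (bisY P i j τ) =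
      num P i j k - τ * det P i j k := by
  simp only [sq, bisX, bisY, num, det]; push_cast; ring

theorem num_self (i j : Fin n) : num P i j j = 0 := by simp [num]
theorem det_self (i j : Fin n) : det P i j j = 0 := by simp only [det]; ring
theorem det_left (i j : Fin n) : det P i j i = 0 := by simp [det]
theorem det_swap (i j k : Fin n) : det P i j k = - det P i k j := by simp only [det]; ring

theorem sq_bis_self (i j : Fin n) (τ : ℝ) :
    sq P j (bisX P i j τ) (bisY P i j τ) = sq P i (bisX P i j τ) (bisY P i j τ) := by
  have := sq_bis (P := P) i j j τ
  rw [num_self, det_self] at this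
  push_cast at this; linarith

theorem exists_bis (hP : Generic P) (hij : i ≠ j) (h : sq P j a b = sq P i a b) :
    ∃ τ, a = bisX P i j τ ∧ b = bisY P i j τ := by
  have hq : ((P.x j : ℝ) - P.x i) ^ 2 + ((P.y j : ℝ) - P.y i) ^ 2 ≠ 0 := by
    intro h0
    have hx : ((P.x j : ℝ) - P.x i) = 0 := by nlinarith [sq_nonneg ((P.x j : ℝ) - P.x i), sq_nonneg ((P.y j : ℝ) - P.y i)]
    have hy : ((P.y j : ℝ) - P.y i) = 0 := by nlinarith [sq_nonneg ((P.x j : ℝ) - P.x i), sq_nonneg ((P.y j : ℝ) - P.y i)]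
    rcases hP.ne i j hij with h | h
    · exact h (by exact_mod_cast (sub_eq_zero.1 hx).symm)
    · exact h (by exact_mod_cast (sub_eq_zero.1 hy).symm)
  -- The component of the point orthogonal to the line through the two sites, in units of half their
  -- distance.
  refine ⟨2 * ((P.x j - P.x i) * (b - P.y i) - (P.y j - P.y i) * (a - P.x i)) /
    (((P.x j : ℝ) - P.x i) ^ 2 + ((P.y j : ℝ) - P.y i) ^ 2), ?_, ?_⟩
  · simp only [sq, bisX] at *
    field_simp
    linear_combination (-(P.x j : ℝ) + P.x i) * h
  · simp only [sq, bisY] at *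
    field_simp
    linear_combination (-(P.y j : ℝ) + P.y i) * h

theorem edgePoint_bis :
    EdgePoint P σ i j (bisX P i j τ) (bisY P i j τ) ↔
      ∀ k, k ≠ i → k ≠ j → 0 < (σ : ℝ) * (num P i j k - τ * det P i j k) := by
  simp only [EdgePoint, sq_bis, sq_bis_self, true_and]

theorem isEdge_iff (hP : Generic P) : IsEdge P σ i j ↔ i ≠ j ∧
    ∃ τ : ℝ, ∀ k, k ≠ i → k ≠ j → 0 < (σ : ℝ) * (num P i j k - τ * det P i j k) := by
  refine and_congr_right fun hij => ⟨fun ⟨a, b, h⟩ => ?_, fun ⟨τ, h⟩ => ⟨_, _, edgePoint_bis.2 h⟩⟩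
  obtain ⟨τ, rfl, rfl⟩ := exists_bis hP hij h.1
  exact ⟨τ, edgePoint_bis.1 h⟩

theorem IsEdge.symm (h : IsEdge P σ i j) : IsEdge P σ j i := by
  obtain ⟨hij, a, b, h1, h2⟩ := h
  exact ⟨hij.symm, a, b, h1.symm, fun k hj hi => by rw [h1]; exact h2 k hi hj⟩

theorem IsEnd.ne (h : IsEnd P σ d i j k) : k ≠ i ∧ k ≠ j := by
  constructor <;> rintro rfl
  · have := h.1; simp [det_left] at this
  · have := h.1; simp [det_self] at this

/-- The parameter of the point where the bisectors of `i`, `j` and of `i`, `k` meet. -/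
noncomputable def par (P : Sites n) (i j k : Fin n) : ℝ := num P i j k / det P i j k

theorem sq_bis_par (hP : Generic P) (hij : i ≠ j) (hik : i ≠ k) (hjk : j ≠ k) :
    sq P k (bisX P i j (par P i j k)) (bisY P i j (par P i j k)) =
      sq P i (bisX P i j (par P i j k)) (bisY P i j (par P i j k)) := by
  have h : (det P i j k : ℝ) ≠ 0 := by exact_mod_cast hP.det_ne i j k hij hik hjk
  have := sq_bis (P := P) i j k (par P i j k)
  rw [par, div_mul_cancel₀ _ h, sub_self] at this
  rw [par]; linarith

/-- On the side `d` of the line from `i` to `j`, the end site gives the strongest constraint. -/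
theorem IsEnd.constraint (hk : IsEnd P σ d i j k)
    (hm : 0 < d * det P i j m) :
    0 ≤ (σ : ℝ) * (num P i j m - par P i j k * det P i j m) := by
  have h0 : (0 : ℝ) < d * det P i j k := by exact_mod_cast hk.1
  have h1 : (σ : ℝ) * d * (num P i j k * det P i j m - num P i j m * det P i j k) ≤ 0 := by
    exact_mod_cast not_lt.1 (hk.2 m hm)
  have h2 : (det P i j k : ℝ) ≠ 0 := by rintro h; simp [h] at h0
  have h3 : par P i j k * det P i j k = num P i j k := div_mul_cancel₀ _ h2
  refine nonneg_of_mul_nonneg_left (b := (d * det P i j k : ℝ)) ?_ h0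
  have h4 : (σ : ℝ) * (num P i j m - par P i j k * det P i j m) * (d * det P i j k) =
      - ((σ : ℝ) * d * (num P i j k * det P i j m - num P i j m * det P i j k)) := by
    linear_combination (-(σ : ℝ) * d * det P i j m) * h3
  linarith

/-- The slopes have opposite signs, so moving from `τ` towards the zero `τ'` of the first constraint
only relaxes the second one. -/
theorem pos_trans_par {σ τ τ' N N' D D' d : ℝ} (hD : 0 < d * D) (hD' : d * D' < 0)
    (hd : d * d = 1) (h0 : N = τ' * D) (h : 0 < σ * (N - τ * D)) (h' : 0 ≤ σ * (N' - τ * D')) :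
    0 < σ * (N' - τ' * D') := by
  subst h0
  have h1 : 0 < (σ * d * (τ' - τ)) * (d * D) := by
    have : (σ * d * (τ' - τ)) * (d * D) = (d * d) * (σ * (τ' * D - τ * D)) := by ring
    rw [this, hd, one_mul]; exact h
  have h2 : 0 < σ * d * (τ' - τ) := pos_of_mul_pos_left h1 hD.le
  have h3 : σ * (N' - τ' * D') = σ * (N' - τ * D') - (d * d) * (σ * (τ' - τ) * D') := by
    rw [hd]; ring
  have h4 : (d * d) * (σ * (τ' - τ) * D') = (σ * d * (τ' - τ)) * (d * D') := by ring
  nlinarith [mul_neg_of_pos_of_neg h2 hD']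

theorem cast_mul_self (hd : d = 1 ∨ d = -1) : (d : ℝ) * d = 1 := by
  rcases hd with rfl | rfl <;> norm_num

theorem sign_det_or (hP : Generic P) (hd : d = 1 ∨ d = -1) (hij : i ≠ j) (hk : k ≠ i)
    (hk' : k ≠ j) : 0 < d * det P i j k ∨ d * det P i j k < 0 := by
  have := hP.det_ne i j k hij hk.symm hk'.symm
  have hd0 : d ≠ 0 := by rcases hd with rfl | rfl <;> norm_num
  exact (mul_ne_zero hd0 this).lt_or_gt.symm

/-- `IsEnd` compares sites on one side only. For those on the other side, start at a point of the
edge and use `pos_trans_par`. On the same side the inequality is strict because no four sites are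
cocircular. -/
theorem IsEnd.vertex (hP : Generic P) (hσ : σ ≠ 0) (hd : d = 1 ∨ d = -1) (he : IsEdge P σ i j)
    (hk : IsEnd P σ d i j k) :
    Vertex P σ i j k (bisX P i j (par P i j k)) (bisY P i j (par P i j k)) := by
  obtain ⟨hij, τ, hτ⟩ := (isEdge_iff hP).1 he
  obtain ⟨hki, hkj⟩ := hk.ne
  refine ⟨hij, hki.symm, hkj.symm, sq_bis_self _ _ _, sq_bis_par hP hij hki.symm hkj.symm,
    fun m hmi hmj hmk => ?_⟩
  have hne := hP.not_cocircular i j k m _ _ hij hki.symm hmi.symm hkj.symm hmj.symm hmk.symm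
    (sq_bis_self i j (par P i j k)) (sq_bis_par hP hij hki.symm hkj.symm)
  rw [sq_bis]
  rcases sign_det_or hP hd hij hmi hmj with hm | hm
  · refine lt_of_le_of_ne (hk.constraint hm) fun h => hne ?_
    rw [eq_comm, mul_eq_zero, or_iff_right (by exact_mod_cast hσ), ← sq_bis] at h
    linarith
  · have h0 : (det P i j k : ℝ) ≠ 0 := by
      exact_mod_cast hP.det_ne i j k hij hki.symm hkj.symm
    exact pos_trans_par (by exact_mod_cast hk.1) (by exact_mod_cast hm) (cast_mul_self hd)
      (div_mul_cancel₀ _ h0).symm (hτ k hki hkj) (hτ m hmi hmj).le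

theorem Vertex.swap (h : Vertex P σ i j k a b) : Vertex P σ i k j a b :=
  ⟨h.ik, h.ij, h.jk.symm, h.sq_k, h.sq_j, fun m h1 h2 h3 => h.pos m h1 h3 h2⟩

theorem Vertex.rotate (h : Vertex P σ i j k a b) : Vertex P σ j k i a b :=
  ⟨h.jk, h.ij.symm, h.ik.symm, h.sq_k.trans h.sq_j.symm, h.sq_j.symm,
    fun m h1 h2 h3 => by rw [h.sq_j]; exact h.pos m h3 h1 h2⟩

/-- Three edges meet at a vertex. -/
theorem Vertex.isEdge (hP : Generic P) (hσ : σ = 1 ∨ σ = -1) (h : Vertex P σ i j k a b) :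
    IsEdge P σ i k := by
  rw [isEdge_iff hP]
  refine ⟨h.ik, ?_⟩
  obtain ⟨τ, rfl, rfl⟩ := exists_bis hP h.ik h.sq_k
  have hpos := h.pos
  have hj := h.sq_j
  simp only [sq_bis] at hpos
  rw [← sub_eq_zero, sq_bis] at hj
  have hD : (det P i k j : ℝ) ≠ 0 := by exact_mod_cast hP.det_ne i k j h.ik h.ij h.jk.symm
  have hs2 : (σ : ℝ) * σ = 1 := cast_mul_self hσ
  -- Leave the vertex along the bisector of `i` and `k`, in the direction in which the constraint of
  -- `j`, tight at the vertex, becomes strict. The remaining constraints are strict at the vertex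
  -- and persist for small `ε`.
  have h1 : ∀ m, m ≠ i → m ≠ j → m ≠ k → ∀ᶠ ε : ℝ in nhdsWithin 0 (Set.Ioi 0),
      0 < (σ : ℝ) * (num P i k m - (τ - ε * σ * det P i k j) * det P i k m) := by
    intro m hi hj hk
    have hc : Continuous fun ε : ℝ =>
        (σ : ℝ) * (num P i k m - (τ - ε * σ * det P i k j) * det P i k m) := by fun_prop
    have := (hc.tendsto 0).eventually (lt_mem_nhds (a := 0) (by simpa using hpos m hi hj hk))
    exact nhdsWithin_le_nhds this
  have h2 : ∀ᶠ ε : ℝ in nhdsWithin 0 (Set.Ioi 0), ∀ m, m ≠ i → m ≠ j → m ≠ k →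
      0 < (σ : ℝ) * (num P i k m - (τ - ε * σ * det P i k j) * det P i k m) := by
    rw [Filter.eventually_all]
    intro m
    by_cases hi : m = i
    · simp [hi]
    by_cases hj : m = j
    · simp [hj]
    by_cases hk : m = k
    · simp [hk]
    filter_upwards [h1 m hi hj hk] with ε h _ _ _ using h
  obtain ⟨ε, h3, hε⟩ := (h2.and self_mem_nhdsWithin).exists
  refine ⟨τ - ε * σ * det P i k j, fun m hmi hmk => ?_⟩
  by_cases hmj : m = j
  · subst hmj
    have h4 : (σ : ℝ) * (num P i k m - (τ - ε * σ * det P i k m) * det P i k m) =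
      ε * (det P i k m : ℝ) ^ 2 := by
      linear_combination (σ : ℝ) * hj + ε * (det P i k m : ℝ) ^ 2 * hs2
    rw [h4]
    have : 0 < ε := hε
    positivity
  · exact h3 m hmi hmj hmk

/-- No edge of the cell of `i` lies between two consecutive ones. -/
theorem Vertex.not_isEdge_between (h : Vertex P σ i j k a b) (hjk : 0 < d * det P i j k)
    (hjl : 0 < d * det P i j l) (hlk : 0 < d * det P i l k) : ¬ IsEdge P σ i l := by
  rintro ⟨hil, a', b', h1, h2⟩
  have hlj : l ≠ j := by rintro rfl; simp [det_self] at hjl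
  have hlk' : l ≠ k := by rintro rfl; simp [det_self] at hlk
  have hp := h.pos l hil.symm hlj hlk'
  have hj := h2 j h.ij.symm hlj.symm
  have hk := h2 k h.ik.symm hlk'.symm
  -- The vector from `i` to `l` is a positive combination of those to `j` and `k`, and `sq P m - sq
  -- P i` is affine with gradient proportional to the vector from `i` to `m`. At the vertex the
  -- terms of `j` and `k` vanish. On an edge for `i` and `l` the left side would be zero, but all
  -- terms on the right are positive.
  have id : (d * det P i j k : ℝ) * ((σ : ℝ) * (sq P l a' b' - sq P i a' b')) =
      (d * det P i l k : ℝ) * ((σ : ℝ) * (sq P j a' b' - sq P i a' b')) +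
      (d * det P i j l : ℝ) * ((σ : ℝ) * (sq P k a' b' - sq P i a' b')) +
      (d * det P i j k : ℝ) * ((σ : ℝ) * (sq P l a b - sq P i a b)) := by
    have e1 := h.sq_j
    have e2 := h.sq_k
    simp only [sq, det] at *
    push_cast
    linear_combination
      (-(d : ℝ) * σ * ((P.x l - P.x i) * (P.y k - P.y i) - (P.y l - P.y i) * (P.x k - P.x i))) * e1
      - ((d : ℝ) * σ * ((P.x j - P.x i) * (P.y l - P.y i) -
        (P.y j - P.y i) * (P.x l - P.x i))) * e2
  rw [h1, sub_self, mul_zero, mul_zero] at id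
  have c1 : (0 : ℝ) < d * det P i j k := by exact_mod_cast hjk
  have c2 : (0 : ℝ) < d * det P i j l := by exact_mod_cast hjl
  have c3 : (0 : ℝ) < d * det P i l k := by exact_mod_cast hlk
  have := mul_pos c3 hj
  have := mul_pos c2 hk
  have := mul_pos c1 hp
  linarith

/-! ### Walking along the boundary of a cell -/

/-- The edges of the cell of `i` that come after `j`, in direction `d`, within the half-plane that
begins at `s`. -/
def After (P : Sites n) (σ d : ℤ) (i s j : Fin n) : Set (Fin n) :=
  {l | IsEdge P σ i l ∧ 0 < d * det P i s l ∧ 0 < d * det P i j l}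

/-- The Grassmann–Plücker relation for the four vectors that start at `i`. -/
theorem det_identity (i s j k l : Fin n) :
    det P i s k * det P i j l = det P i s j * det P i k l + det P i s l * det P i j k := by
  simp only [det]; ring

/-- "Comes after, as seen from `i`" is not transitive on a full circle, but it is so within the
half-plane that begins at `s`. -/
theorem det_trans {s j k l : Fin n} (hd : d = 1 ∨ d = -1) (hj : j = s ∨ 0 < d * det P i s j)
    (hsk : 0 < d * det P i s k) (hsl : 0 < d * det P i s l) (hjk : 0 < d * det P i j k)
    (hkl : 0 < d * det P i k l) : 0 < d * det P i j l := by
  rcases hj with rfl | hj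
  · exact hsl
  · have := det_identity (P := P) i s j k l
    have h1 := mul_pos hj hkl
    have h2 := mul_pos hsl hjk
    refine pos_of_mul_pos_right (a := d * det P i s k) ?_ hsk.le
    rcases hd with rfl | rfl <;> nlinarith

/-- A neighbour after `j` other than `k` cannot lie between `j` and `k`, so it comes after `k`. One
step of the walk thus passes exactly one edge. -/
theorem After.eq_insert {s : Fin n} (hP : Generic P) (hσ : σ = 1 ∨ σ = -1)
    (hd : d = 1 ∨ d = -1) (hij : IsEdge P σ i j) (hj : j = s ∨ 0 < d * det P i s j)
    (hk : IsEnd P σ d i j k) (hsk : 0 < d * det P i s k) :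
    After P σ d i s j = insert k (After P σ d i s k) := by
  have hσ0 : σ ≠ 0 := by rcases hσ with rfl | rfl <;> norm_num
  have hv := hk.vertex hP hσ0 hd hij
  ext l
  simp only [After, Set.mem_insert_iff, Set.mem_ofPred_eq]
  constructor
  · rintro ⟨h1, h2, h3⟩
    by_cases hlk : l = k
    · exact .inl hlk
    refine .inr ⟨h1, h2, ?_⟩
    rcases sign_det_or hP hd hv.ik h1.1.symm hlk with h | h
    · exact h
    · refine absurd h1 (hv.not_isEdge_between hk.1 h3 ?_)
      rw [det_swap]; linarith
  · rintro (rfl | ⟨h1, h2, h3⟩)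
    · exact ⟨hv.isEdge hP hσ, hsk, hk.1⟩
    · exact ⟨h1, h2, det_trans hd hj hsk h2 hk.1 h3⟩

/-- The stopping rule. If the next neighbour `k` is already outside the half-plane, a remaining
neighbour inside would lie between `j` and `k`. -/
theorem After.eq_empty {s : Fin n} (hP : Generic P) (hσ : σ = 1 ∨ σ = -1)
    (hd : d = 1 ∨ d = -1) (hij : IsEdge P σ i j) (hj : j = s ∨ 0 < d * det P i s j)
    (hk : (∀ l, ¬ 0 < d * det P i j l) ∨ (IsEnd P σ d i j k ∧ ¬ 0 < d * det P i s k)) :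
    After P σ d i s j = ∅ := by
  have hσ0 : σ ≠ 0 := by rcases hσ with rfl | rfl <;> norm_num
  rw [Set.eq_empty_iff_forall_notMem]
  rintro l ⟨h1, h2, h3⟩
  rcases hk with hk | ⟨hk, hsk⟩
  · exact hk l h3
  · have hv := hk.vertex hP hσ0 hd hij
    rcases hj with rfl | hj
    · exact hsk hk.1
    · refine hv.not_isEdge_between hk.1 h3 ?_ h1
      have := det_identity (P := P) i s j k l
      have e1 := mul_pos h2 hk.1
      have e2 := mul_nonneg (neg_nonneg.2 (not_lt.1 hsk)) h3.le
      have e3 := det_swap (P := P) i l k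
      refine pos_of_mul_pos_right (a := d * det P i s j) ?_ hj.le
      rw [e3]
      rcases hd with rfl | rfl <;> nlinarith

theorem After.notMem_self {s : Fin n} : k ∉ After P σ d i s k := by
  rintro ⟨-, -, h⟩
  simp [det_self] at h

end Geometry

section Geometry

variable {n : ℕ} {P : Sites n} {σ d : ℤ} {i j k l m e g : Fin n} {a b τ : ℝ}

/-! ### The ends of an edge -/

/-- `e` bounds the edge for `i` and `j` on the side `d`, where `e = j` means that nothing does. -/
def EndSpec (P : Sites n) (σ d : ℤ) (i j e : Fin n) : Prop :=
  (e = j ∧ ∀ l, ¬ 0 < d * det P i j l) ∨ IsEnd P σ d i j e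

theorem EndSpec.isEnd (h : EndSpec P σ d i j e) (h' : 0 < d * det P i j l) :
    IsEnd P σ d i j e := h.resolve_left fun h => h.2 l h'

theorem pos_iff_par {N D σ d τ : ℝ} (hd : d * d = 1) (h : 0 < d * D) :
    0 < σ * (N - τ * D) ↔ 0 < σ * d * (N / D - τ) := by
  have hD : D ≠ 0 := by rintro rfl; simp at h
  have : σ * (N - τ * D) = (σ * d * (N / D - τ)) * (d * D) := by
    field_simp
    linear_combination (-σ * (N - D * τ)) * hd
  rw [this]
  exact ⟨fun h1 => pos_of_mul_pos_left h1 h.le, fun h1 => mul_pos h1 h⟩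

theorem neg_one_or (hd : d = 1 ∨ d = -1) : -d = 1 ∨ -d = -1 := by
  rcases hd with rfl | rfl <;> simp

/-- Only the tightest constraint on each side matters. The premises on the right are false for a
placeholder end `j`, where `det` vanishes, so the four cases share one formula. -/
theorem feasible_iff (hP : Generic P) (hd : d = 1 ∨ d = -1) (hij : i ≠ j)
    (he : EndSpec P σ d i j e) (hg : EndSpec P σ (-d) i j g) :
    (∀ k, k ≠ i → k ≠ j → 0 < (σ : ℝ) * (num P i j k - τ * det P i j k)) ↔
      (0 < d * det P i j e → 0 < (σ : ℝ) * d * (par P i j e - τ)) ∧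
      (0 < -d * det P i j g → 0 < (σ : ℝ) * d * (τ - par P i j g)) := by
  have key : ∀ (d : ℤ) (e : Fin n), (d = 1 ∨ d = -1) → 0 < d * det P i j e →
      (0 < (σ : ℝ) * (num P i j e - τ * det P i j e) ↔
        0 < (σ : ℝ) * d * (par P i j e - τ)) := fun d e hd h =>
    pos_iff_par (cast_mul_self hd) (by exact_mod_cast h)
  have key2 : ∀ (d : ℤ) (e k : Fin n), (d = 1 ∨ d = -1) → EndSpec P σ d i j e →
      (0 < d * det P i j e → 0 < (σ : ℝ) * d * (par P i j e - τ)) →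
      0 < d * det P i j k → 0 < (σ : ℝ) * (num P i j k - τ * det P i j k) := by
    intro d e k hd he h1 hk
    have hend := he.isEnd hk
    have h2 := h1 hend.1
    have h3 := hend.constraint hk
    have h4 : (0 : ℝ) < d * det P i j k := by exact_mod_cast hk
    have h5 := mul_pos h2 h4
    have h6 := cast_mul_self hd
    have h7 : (σ : ℝ) * d * (par P i j e - τ) * (d * det P i j k) =
      σ * (par P i j e - τ) * det P i j k := by
      linear_combination ((σ : ℝ) * (par P i j e - τ) * det P i j k) * h6
    nlinarith
  have hneg : (σ : ℝ) * ((-d : ℤ) : ℝ) * (par P i j g - τ) =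
      (σ : ℝ) * d * (τ - par P i j g) := by push_cast; ring
  rw [← hneg]
  constructor
  · intro h
    refine ⟨fun h1 => ?_, fun h1 => ?_⟩
    · have := (he.isEnd h1).ne
      exact (key d e hd h1).1 (h e this.1 this.2)
    · have := (hg.isEnd h1).ne
      exact (key (-d) g (neg_one_or hd) h1).1 (h g this.1 this.2)
  · rintro ⟨h1, h2⟩ k hki hkj
    rcases sign_det_or hP hd hij hki hkj with h | h
    · exact key2 d e k hd he h1 h
    · exact key2 (-d) g k (neg_one_or hd) hg h2 (by linarith)

/-- The test whether `i` and `j` have an edge, in terms of the two sites that bound it. -/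
theorem isEdge_iff_of_ends (hP : Generic P) (hσ : σ = 1 ∨ σ = -1) (hd : d = 1 ∨ d = -1)
    (hij : i ≠ j) (he : EndSpec P σ d i j e) (hg : EndSpec P σ (-d) i j g) :
    IsEdge P σ i j ↔ ¬ (0 < -(det P i j e * det P i j g) ∧
      ¬ 0 < σ * d * (num P i j g * det P i j e - num P i j e * det P i j g)) := by
  rw [isEdge_iff hP, and_iff_right hij]
  simp only [feasible_iff hP hd hij he hg]
  have hs : ((σ : ℝ) * d) * (σ * d) = 1 := by
    linear_combination (d : ℝ) * d * cast_mul_self hσ + cast_mul_self hd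
  have hdd : d * d = 1 := by rcases hd with rfl | rfl <;> norm_num
  -- The product in the test is negative iff both ends exist; then the bounds must be in strict
  -- order, with their average as the witness. If one end is missing, a point one unit beyond the
  -- other bound is feasible.
  by_cases h1 : 0 < d * det P i j e
  · by_cases h2 : 0 < -d * det P i j g
    · have h3 : -(det P i j e * det P i j g) = (d * det P i j e) * (-d * det P i j g) := by
        linear_combination (det P i j e * det P i j g) * hdd
      have h4 := mul_pos h1 h2
      rw [← h3] at h4
      simp only [h1, h2, h4, true_and, not_not, forall_const]
      have h5 : (0 : ℝ) < -(det P i j e * det P i j g) := by exact_mod_cast h4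
      have e0 : (det P i j e : ℝ) ≠ 0 := by rintro h; simp [h] at h5
      have g0 : (det P i j g : ℝ) ≠ 0 := by rintro h; simp [h] at h5
      have h6 : ((σ * d * (num P i j g * det P i j e - num P i j e * det P i j g) : ℤ) : ℝ) =
          ((σ : ℝ) * d * (par P i j e - par P i j g)) * -(det P i j e * det P i j g) := by
        simp only [par]; push_cast; field_simp; ring
      have h7 : 0 < σ * d * (num P i j g * det P i j e - num P i j e * det P i j g) ↔
          0 < (σ : ℝ) * d * (par P i j e - par P i j g) := by
        rw [← Int.cast_pos (R := ℝ), h6]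
        exact ⟨fun h => pos_of_mul_pos_left h h5.le, fun h => mul_pos h h5⟩
      rw [h7]
      constructor
      · rintro ⟨τ, h8, h9⟩; linarith
      · intro h; exact ⟨(par P i j e + par P i j g) / 2, by linarith, by linarith⟩
    · refine ⟨fun _ h => ?_, fun _ => ⟨par P i j e - σ * d, fun _ => ?_, fun h => absurd h h2⟩⟩
      · have h3 : -(det P i j e * det P i j g) = (d * det P i j e) * (-d * det P i j g) := by
          linear_combination (det P i j e * det P i j g) * hdd
        have := mul_nonneg h1.le (neg_nonneg.2 (not_lt.1 h2))
        linarith [h.1]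
      · rw [sub_sub_cancel, hs]; exact one_pos
  · refine ⟨fun _ h => ?_, fun _ => ⟨par P i j g + σ * d, fun h => absurd h h1, fun _ => ?_⟩⟩
    · have h2 : e = j := (he.resolve_right fun h => h1 h.1).1
      have := h.1
      simp [h2, det_self] at this
    · rw [add_sub_cancel_left, hs]; exact one_pos

/-! ### Records of edges -/

/-- The points of the plane on the edge for `i` and `j`. -/
def edgeSet (P : Sites n) (σ : ℤ) (i j : Fin n) : Set Plane :=
  {z | EdgePoint P σ i j (z 0) (z 1)}

/-- Homogeneous coordinates of the centre of the circle through `i`, `j`, `e`. -/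
def endX (P : Sites n) (d : ℤ) (i j e : Fin n) : ℤ :=
  d * (det P i j e * (P.x i + P.x j) - num P i j e * (P.y j - P.y i))

def endY (P : Sites n) (d : ℤ) (i j e : Fin n) : ℤ :=
  d * (det P i j e * (P.y i + P.y j) + num P i j e * (P.x j - P.x i))

/-- The factor `d`, present in all three coordinates, makes this one positive for a site on the side
`d`, as `EdgeRecord.Describes` demands. -/
def endW (P : Sites n) (d : ℤ) (i j e : Fin n) : ℤ := 2 * (d * det P i j e)

/-- The record of an edge with two finite ends. -/
def segmentRecord (P : Sites n) (d : ℤ) (i j e g : Fin n) : EdgeRecord ℤ :=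
  ⟨(i : ℕ), (j : ℕ), endX P d i j e, endY P d i j e, endW P d i j e,
    endX P (-d) i j g, endY P (-d) i j g, endW P (-d) i j g⟩

/-- The record of an edge whose only finite end is on the side `d`. -/
def halflineRecord (P : Sites n) (σ d : ℤ) (i j e : Fin n) : EdgeRecord ℤ :=
  ⟨(i : ℕ), (j : ℕ), endX P d i j e, endY P d i j e, endW P d i j e,
    σ * d * (P.y j - P.y i), σ * d * (P.x i - P.x j), 0⟩

theorem endX_div (hd : d = 1 ∨ d = -1) (h : det P i j e ≠ 0) :
    (endX P d i j e : ℝ) / endW P d i j e = bisX P i j (par P i j e) := by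
  have h0 : (det P i j e : ℝ) ≠ 0 := by exact_mod_cast h
  simp only [endX, endW, bisX, par]
  rcases hd with rfl | rfl <;> push_cast <;> field_simp <;> ring

theorem endY_div (hd : d = 1 ∨ d = -1) (h : det P i j e ≠ 0) :
    (endY P d i j e : ℝ) / endW P d i j e = bisY P i j (par P i j e) := by
  have h0 : (det P i j e : ℝ) ≠ 0 := by exact_mod_cast h
  simp only [endY, endW, bisY, par]
  rcases hd with rfl | rfl <;> push_cast <;> field_simp <;> ring

theorem mem_edgeSet_iff (hP : Generic P) (hij : i ≠ j) {z : Plane} :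
    z ∈ edgeSet P σ i j ↔ ∃ τ : ℝ, z = !₂[bisX P i j τ, bisY P i j τ] ∧
      ∀ k, k ≠ i → k ≠ j → 0 < (σ : ℝ) * (num P i j k - τ * det P i j k) := by
  constructor
  · intro h
    obtain ⟨τ, h1, h2⟩ := exists_bis hP hij h.1
    refine ⟨τ, ?_, ?_⟩
    · ext q; fin_cases q
      · simpa using h1
      · simpa using h2
    · rw [← edgePoint_bis, ← h1, ← h2]; exact h
  · rintro ⟨τ, rfl, h⟩
    simpa [edgeSet] using edgePoint_bis.2 h

theorem IsEnd.det_ne (h : IsEnd P σ d i j e) : det P i j e ≠ 0 := by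
  intro h0; have := h.1; simp [h0] at this

/-- The parametrisation of the bisector is affine and the feasible parameters form the open interval
between the two bounds. -/
theorem carrier_segmentRecord (hP : Generic P) (hd : d = 1 ∨ d = -1)
    (hij : IsEdge P σ i j) (he : IsEnd P σ d i j e) (hg : IsEnd P σ (-d) i j g) :
    (segmentRecord P d i j e g).carrier = edgeSet P σ i j := by
  have hw : (segmentRecord P d i j e g).w₂ ≠ 0 := by
    have := hg.1
    simp only [segmentRecord, endW]; omega
  rw [EdgeRecord.carrier, if_neg hw]
  simp only [segmentRecord, endX_div hd he.det_ne, endY_div hd he.det_ne,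
    endX_div (neg_one_or hd) hg.det_ne, endY_div (neg_one_or hd) hg.det_ne]
  have hf := fun τ => feasible_iff (τ := τ) hP hd hij.1 (.inr he) (.inr hg)
  simp only [he.1, hg.1, forall_const] at hf
  obtain ⟨-, τ₀, hτ₀⟩ := (isEdge_iff hP).1 hij
  obtain ⟨h1, h2⟩ := (hf τ₀).1 hτ₀
  have h3 : 0 < (σ : ℝ) * d * (par P i j e - par P i j g) := by linarith
  ext z
  rw [mem_edgeSet_iff hP hij.1, openSegment_eq_image']
  simp only [hf, Set.mem_image, Set.mem_Ioo]
  constructor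
  · rintro ⟨θ, ⟨h4, h5⟩, rfl⟩
    refine ⟨par P i j e + θ * (par P i j g - par P i j e), ?_, ?_, ?_⟩
    · ext q; fin_cases q
      · simp [bisX]; ring
      · simp [bisY]; ring
    · have := mul_pos h4 h3; linarith
    · have := mul_pos (sub_pos.2 h5) h3; linarith
  · rintro ⟨τ, rfl, h4, h5⟩
    have hne : par P i j e - par P i j g ≠ 0 := by rintro h; simp [h] at h3
    have hsd : (σ : ℝ) * d ≠ 0 := by rintro h; simp [h] at h3
    -- The factor `σ * d` makes numerator and denominator positive, whichever bound is the larger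
    -- one.
    have hθ : (par P i j e - τ) / (par P i j e - par P i j g) =
        ((σ : ℝ) * d * (par P i j e - τ)) / ((σ : ℝ) * d * (par P i j e - par P i j g)) :=
      (mul_div_mul_left _ _ hsd).symm
    refine ⟨(par P i j e - τ) / (par P i j e - par P i j g), ⟨?_, ?_⟩, ?_⟩
    · rw [hθ]; positivity
    · rw [hθ, div_lt_one h3]; linarith
    · ext q; fin_cases q
      · simp [bisX]; field_simp; ring
      · simp [bisY]; field_simp; ring

theorem carrier_halflineRecord (hP : Generic P) (hσ : σ = 1 ∨ σ = -1) (hd : d = 1 ∨ d = -1)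
    (hij : IsEdge P σ i j) (he : IsEnd P σ d i j e) (hg : ∀ l, ¬ 0 < -d * det P i j l) :
    (halflineRecord P σ d i j e).carrier = edgeSet P σ i j := by
  have hw : (halflineRecord P σ d i j e).w₂ = 0 := rfl
  rw [EdgeRecord.carrier, if_pos hw]
  simp only [halflineRecord, endX_div hd he.det_ne, endY_div hd he.det_ne]
  have hf := fun τ => feasible_iff (τ := τ) hP hd hij.1 (.inr he) (.inl ⟨rfl, hg⟩)
  simp only [he.1, hg, forall_const, false_imp_iff, and_true] at hf
  have hs : ((σ : ℝ) * d) * (σ * d) = 1 := by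
    linear_combination (d : ℝ) * d * cast_mul_self hσ + cast_mul_self hd
  ext z
  rw [mem_edgeSet_iff hP hij.1]
  simp only [hf, Set.mem_ofPred_eq]
  constructor
  · rintro ⟨t, h4, rfl⟩
    -- The recorded direction is `-2 * σ * d` times the velocity of the parametrisation.
    refine ⟨par P i j e - 2 * t * (σ * d), ?_, ?_⟩
    · ext q; fin_cases q
      · simp [bisX]; ring
      · simp [bisY]; ring
    · rw [sub_sub_cancel]
      have : (σ : ℝ) * d * (2 * t * (σ * d)) = 2 * t := by linear_combination (2 * t) * hs
      rw [this]; linarith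
  · rintro ⟨τ, rfl, h4⟩
    refine ⟨(σ : ℝ) * d * (par P i j e - τ) / 2, by linarith, ?_⟩
    ext q; fin_cases q
    · simp [bisX]
      linear_combination (-(par P i j e - τ) / 2 * (P.y j - P.y i)) * hs
    · simp [bisY]
      linear_combination ((par P i j e - τ) / 2 * (P.x j - P.x i)) * hs

/-! ### Translation of the definitions into coordinates -/

theorem dist_point_le_iff (z : Plane) (i j : Fin n) :
    dist z (P.point i) ≤ dist z (P.point j) ↔ sq P i (z 0) (z 1) ≤ sq P j (z 0) (z 1) := by
  simp only [EuclideanSpace.dist_eq, Sites.point, Fin.sum_univ_two, Real.dist_eq, sq_abs, sq]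
  exact Real.sqrt_le_sqrt_iff (by positivity)

theorem nvdEdge_eq (hij : i ≠ j) : nvdEdge P.point i j = edgeSet P 1 i j := by
  ext z
  simp only [nvdEdge, nearestSites, edgeSet, EdgePoint, Set.mem_ofPred_eq, dist_point_le_iff,
    Set.ext_iff, Set.mem_insert_iff, Set.mem_singleton_iff, Int.cast_one, one_mul, sub_pos]
  constructor
  · intro h
    have hi := (h i).2 (.inl rfl)
    have hj := (h j).2 (.inr rfl)
    refine ⟨le_antisymm (hj i) (hi j), fun k hki hkj => ?_⟩
    by_contra hk
    have := (h k).1 fun l => (not_lt.1 hk).trans (hi l)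
    tauto
  · rintro ⟨h1, h2⟩ k
    have h3 : ∀ l, sq P i (z 0) (z 1) ≤ sq P l (z 0) (z 1) := by
      intro l
      by_cases hi : l = i
      · rw [hi]
      by_cases hj : l = j
      · rw [hj, h1]
      exact (h2 l hi hj).le
    constructor
    · intro hk
      by_contra hne
      push Not at hne
      exact absurd (hk i) (not_le.2 (h2 k hne.1 hne.2))
    · rintro (rfl | rfl)
      · exact h3
      · rw [h1]; exact h3

theorem fvdEdge_eq (hij : i ≠ j) : fvdEdge P.point i j = edgeSet P (-1) i j := by
  ext z
  simp only [fvdEdge, farthestSites, edgeSet, EdgePoint, Set.mem_ofPred_eq, dist_point_le_iff,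
    Set.ext_iff, Set.mem_insert_iff, Set.mem_singleton_iff, Int.cast_neg, Int.cast_one,
    neg_mul, one_mul, neg_sub, sub_pos]
  constructor
  · intro h
    have hi := (h i).2 (.inl rfl)
    have hj := (h j).2 (.inr rfl)
    refine ⟨le_antisymm (hi j) (hj i), fun k hki hkj => ?_⟩
    by_contra hk
    have := (h k).1 fun l => (hi l).trans (not_lt.1 hk)
    tauto
  · rintro ⟨h1, h2⟩ k
    have h3 : ∀ l, sq P l (z 0) (z 1) ≤ sq P i (z 0) (z 1) := by
      intro l
      by_cases hi : l = i
      · rw [hi]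
      by_cases hj : l = j
      · rw [hj, h1]
      exact (h2 l hi hj).le
    constructor
    · intro hk
      by_contra hne
      push Not at hne
      exact absurd (hk i) (not_le.2 (h2 k hne.1 hne.2))
    · rintro (rfl | rfl)
      · exact h3
      · rw [h1]; exact h3

theorem GeneralPosition.generic (h : GeneralPosition P.point) : Generic P where
  ne i j hij := by
    by_contra hne
    push Not at hne
    exact hij (h.injective (by simp [Sites.point, hne.1, hne.2]))
  det_ne i j k hij hik hjk h0 := by
    apply h.no_three_on_line i j k hij hik hjk
    have hne : P.point i ≠ P.point j := fun e => hij (h.injective e)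
    have hq : ((P.x j : ℝ) - P.x i) ^ 2 + ((P.y j : ℝ) - P.y i) ^ 2 ≠ 0 := by
      intro h1
      have hx : ((P.x j : ℝ) - P.x i) = 0 := by
        nlinarith [sq_nonneg ((P.x j : ℝ) - P.x i), sq_nonneg ((P.y j : ℝ) - P.y i)]
      have hy : ((P.y j : ℝ) - P.y i) = 0 := by
        nlinarith [sq_nonneg ((P.x j : ℝ) - P.x i), sq_nonneg ((P.y j : ℝ) - P.y i)]
      exact hne (by simp [Sites.point, sub_eq_zero.1 hx, sub_eq_zero.1 hy])
    have h0' : ((P.x j : ℝ) - P.x i) * (P.y k - P.y i) - (P.y j - P.y i) * (P.x k - P.x i) = 0 := by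
      simp only [det] at h0
      exact_mod_cast h0
    rw [collinear_iff_of_mem (p₀ := P.point i) (by simp)]
    refine ⟨P.point j - P.point i, ?_⟩
    simp only [Set.mem_insert_iff, Set.mem_singleton_iff, forall_eq_or_imp, forall_eq]
    -- The multiplier for `k` is the coefficient of its orthogonal projection to the line.
    refine ⟨⟨0, by simp⟩, ⟨1, by simp⟩,
      (((P.x j : ℝ) - P.x i) * (P.x k - P.x i) + (P.y j - P.y i) * (P.y k - P.y i)) /
        (((P.x j : ℝ) - P.x i) ^ 2 + ((P.y j : ℝ) - P.y i) ^ 2), ?_⟩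
    ext q; fin_cases q
    · simp [Sites.point]
      field_simp
      linear_combination (-(P.y j : ℝ) + P.y i) * h0'
    · simp [Sites.point]
      field_simp
      linear_combination ((P.x j : ℝ) - P.x i) * h0'
  not_cocircular i j k l a b hij hik hil hjk hjl hkl hj hk hl := by
    apply h.no_four_on_circle i j k l hij hik hil hjk hjl hkl
    have key : ∀ m, sq P m a b = sq P i a b →
        dist (P.point m) (!₂[a, b] : Plane) = dist (P.point i) (!₂[a, b] : Plane) := by
      intro m hm
      rw [dist_comm, dist_comm (P.point i)]
      apply le_antisymm
      · rw [dist_point_le_iff]; simpa using hm.le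
      · rw [dist_point_le_iff]; simpa using hm.ge
    refine ⟨!₂[a, b], dist (P.point i) (!₂[a, b] : Plane), ?_⟩
    simp only [Set.mem_insert_iff, Set.mem_singleton_iff, forall_eq_or_imp, forall_eq]
    exact ⟨trivial, key j hj, key k hk, key l hl⟩

end Geometry

section Counting

variable {n : ℕ} {P : Sites n} {σ d : ℤ} {i j k l m p q p' q' : Fin n} {a b a' b' : ℝ}

/-! ### The number of edges is linear -/

/-- With denominators cleared, `IsEnd` asks for a minimum of `σ * d * par` over the sites on the
side `d`. -/
theorem exists_isEnd (hd : d = 1 ∨ d = -1) (h : 0 < d * det P i j l) :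
    ∃ k, IsEnd P σ d i j k := by
  classical
  obtain ⟨k, hk, hmin⟩ := Finset.exists_min_image
    (Finset.univ.filter fun m => 0 < d * det P i j m) (fun m => (σ : ℝ) * d * par P i j m)
    ⟨l, by simpa using h⟩
  simp only [Finset.mem_filter, Finset.mem_univ, true_and] at hk hmin
  refine ⟨k, hk, fun m hm => not_lt.2 ?_⟩
  have h1 : (0 : ℝ) < d * det P i j k := by exact_mod_cast hk
  have h2 : (0 : ℝ) < d * det P i j m := by exact_mod_cast hm
  have k0 : (det P i j k : ℝ) ≠ 0 := by rintro h; simp [h] at h1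
  have m0 : (det P i j m : ℝ) ≠ 0 := by rintro h; simp [h] at h2
  have h3 : ((σ * d * (num P i j k * det P i j m - num P i j m * det P i j k) : ℤ) : ℝ) =
      ((σ : ℝ) * d * par P i j k - σ * d * par P i j m) *
        ((d * det P i j k) * (d * det P i j m)) := by
    have e : (d : ℝ) * d = 1 := cast_mul_self hd
    have e1 : par P i j k * det P i j k = num P i j k := div_mul_cancel₀ _ k0
    have e2 : par P i j m * det P i j m = num P i j m := div_mul_cancel₀ _ m0
    push_cast
    rw [← e1, ← e2]
    linear_combination (-(σ : ℝ) * d * (par P i j k - par P i j m) * det P i j k * det P i j m) * e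
  have h4 : ((σ * d * (num P i j k * det P i j m - num P i j m * det P i j k) : ℤ) : ℝ) ≤ 0 := by
    rw [h3]
    exact mul_nonpos_of_nonpos_of_nonneg (sub_nonpos.2 (hmin m hm)) (mul_pos h1 h2).le
  exact_mod_cast h4

/-- A third site is off the line through `i` and `j`. So no edge is a full line, which both the
record format and the counting by vertices require. -/
theorem exists_isEnd_of_three_le (hP : Generic P) (hn : 3 ≤ n) (hij : i ≠ j) :
    ∃ d k, (d = 1 ∨ d = -1) ∧ IsEnd P σ d i j k := by
  obtain ⟨l, hl⟩ : ∃ l, l ∉ ({i, j} : Finset (Fin n)) := by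
    by_contra! h
    have h1 := Finset.card_le_card (fun x _ => h x : (Finset.univ : Finset (Fin n)) ⊆ {i, j})
    have h2 := Finset.card_le_two (a := i) (b := j)
    rw [Finset.card_univ, Fintype.card_fin] at h1
    omega
  simp only [Finset.mem_insert, Finset.mem_singleton, not_or] at hl
  rcases sign_det_or (d := 1) hP (.inl rfl) hij hl.1 hl.2 with h | h
  · obtain ⟨k, hk⟩ := exists_isEnd (σ := σ) (.inl rfl) h
    exact ⟨1, k, .inl rfl, hk⟩
  · obtain ⟨k, hk⟩ := exists_isEnd (P := P) (σ := σ) (d := -1) (i := i) (j := j) (l := l)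
      (.inr rfl) (by linarith)
    exact ⟨-1, k, .inr rfl, hk⟩

/-- The position of a site along the direction `(1, t)`. -/
def height (P : Sites n) (t : ℝ) (i : Fin n) : ℝ := P.x i + t * P.y i

/-- Each pair of sites excludes at most one slope. -/
theorem exists_height_injective (hP : Generic P) : ∃ t, Function.Injective (height P t) := by
  have hfin : (⋃ z : Fin n × Fin n,
      {t : ℝ | t = (P.x z.2 - P.x z.1) / (P.y z.1 - P.y z.2)}).Finite :=
    Set.finite_iUnion fun z => by
      simp
  obtain ⟨t, ht⟩ := hfin.infinite_compl.nonempty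
  simp only [Set.mem_compl_iff, Set.mem_iUnion, Set.mem_ofPred_eq, not_exists] at ht
  refine ⟨t, fun i j h => ?_⟩
  by_contra hij
  simp only [height] at h
  by_cases hy : P.y i = P.y j
  · rw [hy] at h
    have hx : (P.x i : ℝ) = P.x j := by linarith
    rcases hP.ne i j hij with h1 | h1
    · exact h1 (by exact_mod_cast hx)
    · exact h1 hy
  · have hy' : (P.y i : ℝ) - P.y j ≠ 0 := sub_ne_zero.2 (by exact_mod_cast hy)
    refine ht (i, j) ?_
    rw [eq_div_iff hy']
    linarith

theorem Vertex.nonneg (h : Vertex P σ m p q a b) (k : Fin n) :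
    0 ≤ (σ : ℝ) * (sq P k a b - sq P m a b) := by
  by_cases h1 : k = m
  · simp [h1]
  by_cases h2 : k = p
  · simp [h2, h.sq_j]
  by_cases h3 : k = q
  · simp [h3, h.sq_k]
  exact (h.pos k h1 h2 h3).le

/-- The coefficients cancel the height components of the vectors from `m` to `p` and `q`. The
combination then varies only with `t * a - b`, in a sense given by the sign of `det`; they are
positive when `m` is the middle site. This exhibits the vertex as extreme in the cell of `m`. -/
theorem sq_combination (t : ℝ) (m p q : Fin n) (a b a' b' : ℝ) :
    (height P t q - height P t m) * (sq P p a' b' - sq P m a' b') +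
      (height P t m - height P t p) * (sq P q a' b' - sq P m a' b') =
    (height P t q - height P t m) * (sq P p a b - sq P m a b) +
      (height P t m - height P t p) * (sq P q a b - sq P m a b) -
      2 * det P m p q * (t * (a' - a) - (b' - b)) := by
  simp only [height, sq, det]; push_cast; ring

/-- A vertex is extreme in the closed cell of its middle site, and the cell has only one extreme
point of each kind. -/
theorem Vertex.unique {t : ℝ} (h : Vertex P σ m p q a b)
    (h' : Vertex P σ m p' q' a' b') (h1 : height P t p < height P t m)
    (h2 : height P t m < height P t q) (h1' : height P t p' < height P t m)
    (h2' : height P t m < height P t q') (hs : 0 < det P m p q * det P m p' q') :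
    p = p' ∧ q = q' := by
  have c := sq_combination (P := P) t m p q a b a' b'
  have c' := sq_combination (P := P) t m p' q' a' b' a b
  rw [h.sq_j, h.sq_k] at c
  rw [h'.sq_j, h'.sq_k] at c'
  have A := mul_nonneg (sub_pos.2 h2).le (h'.nonneg p)
  have B := mul_nonneg (sub_pos.2 h1).le (h'.nonneg q)
  have A' := mul_nonneg (sub_pos.2 h2').le (h.nonneg p')
  have B' := mul_nonneg (sub_pos.2 h1').le (h.nonneg q')
  have hs' : (0 : ℝ) < det P m p q * det P m p' q' := by exact_mod_cast hs
  have u1 : (det P m p q : ℝ) * (σ * (t * (a' - a) - (b' - b))) ≤ 0 := by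
    have := congrArg (fun r => (σ : ℝ) * r) c
    linarith
  have u2 : 0 ≤ (det P m p' q' : ℝ) * (σ * (t * (a' - a) - (b' - b))) := by
    have := congrArg (fun r => (σ : ℝ) * r) c'
    linarith
  have u0 : (σ : ℝ) * (t * (a' - a) - (b' - b)) = 0 := by
    set u := (σ : ℝ) * (t * (a' - a) - (b' - b))
    have h3 : ((det P m p q : ℝ) * u) * (det P m p' q' * u) ≤ 0 :=
      mul_nonpos_of_nonpos_of_nonneg u1 u2
    have h4 : ((det P m p q : ℝ) * det P m p' q') * (u * u) ≤ 0 := by linarith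
    have h5 := nonpos_of_mul_nonpos_right h4 hs'
    exact mul_self_eq_zero.1 (le_antisymm h5 (mul_self_nonneg u))
  have s0 : (height P t q - height P t m) * ((σ : ℝ) * (sq P p a' b' - sq P m a' b')) +
      (height P t m - height P t p) * ((σ : ℝ) * (sq P q a' b' - sq P m a' b')) = 0 := by
    linear_combination (σ : ℝ) * c - 2 * (det P m p q : ℝ) * u0
  have hp : (σ : ℝ) * (sq P p a' b' - sq P m a' b') = 0 :=
    (mul_eq_zero.1 (by linarith : (height P t q - height P t m) *
      ((σ : ℝ) * (sq P p a' b' - sq P m a' b')) = 0)).resolve_left (sub_pos.2 h2).ne'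
  have hq : (σ : ℝ) * (sq P q a' b' - sq P m a' b') = 0 :=
    (mul_eq_zero.1 (by linarith : (height P t m - height P t p) *
      ((σ : ℝ) * (sq P q a' b' - sq P m a' b')) = 0)).resolve_left (sub_pos.2 h1).ne'
  have mem : ∀ k, k ≠ m → (σ : ℝ) * (sq P k a' b' - sq P m a' b') = 0 → k = p' ∨ k = q' := by
    intro k hk h0
    by_contra! hne
    exact (h'.pos k hk hne.1 hne.2).ne' h0
  constructor
  · rcases mem p h.ij.symm hp with h3 | h3
    · exact h3
    · rw [h3] at h1; linarith
  · rcases mem q h.ik.symm hq with h3 | h3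
    · rw [h3] at h2; linarith
    · exact h3

open Classical in
/-- The sites whose cells share an edge with the cell of `i`. -/
noncomputable def neighbors (P : Sites n) (σ : ℤ) (i : Fin n) : Finset (Fin n) :=
  Finset.univ.filter (IsEdge P σ i)

theorem mem_neighbors : j ∈ neighbors P σ i ↔ IsEdge P σ i j := by simp [neighbors]

/-- By `Vertex.unique`, a vertex is determined by its middle site and one sign, which leaves at most
`2 * n` triples. Every edge has a vertex, and a triple contains six ordered pairs. -/
theorem sum_card_neighbors_le (hP : Generic P) (hσ : σ = 1 ∨ σ = -1) (hn : 3 ≤ n) :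
    ∑ i, (neighbors P σ i).card ≤ 12 * n := by
  classical
  have hσ0 : σ ≠ 0 := by rcases hσ with rfl | rfl <;> norm_num
  obtain ⟨t, ht⟩ := exists_height_injective hP
  let T : Finset (Fin n × Fin n × Fin n) := Finset.univ.filter fun z =>
    (∃ a b, Vertex P σ z.1 z.2.1 z.2.2 a b) ∧ height P t z.2.1 < height P t z.1 ∧
      height P t z.1 < height P t z.2.2
  have hT : T.card ≤ 2 * n := by
    have h1 : T.card ≤ (Finset.univ : Finset (Fin n × Bool)).card := by
      refine Finset.card_le_card_of_injOn (fun z => (z.1, decide (0 < det P z.1 z.2.1 z.2.2)))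
        (by simp) ?_
      rintro ⟨m, p, q⟩ hz ⟨m', p', q'⟩ hz' heq
      simp only [T, Finset.coe_filter, Finset.mem_univ, true_and, Set.mem_ofPred_eq] at hz hz'
      obtain ⟨⟨a, b, h⟩, h1, h2⟩ := hz
      obtain ⟨⟨a', b', h'⟩, h1', h2'⟩ := hz'
      simp only [Prod.mk.injEq, decide_eq_decide] at heq
      obtain ⟨rfl, heq⟩ := heq
      have hd := hP.det_ne m p q h.ij h.ik h.jk
      have hd' := hP.det_ne m p' q' h'.ij h'.ik h'.jk
      have hs : 0 < det P m p q * det P m p' q' := by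
        rcases hd.lt_or_gt with h3 | h3
        · have h4 : det P m p' q' < 0 :=
            lt_of_le_of_ne (not_lt.1 fun h5 => by have := heq.2 h5; omega) hd'
          exact mul_pos_of_neg_of_neg h3 h4
        · exact mul_pos h3 (heq.1 h3)
      obtain ⟨rfl, rfl⟩ := h.unique h' h1 h2 h1' h2' hs
      rfl
    simpa [mul_comm] using h1
  let f : Fin 6 → Fin n × Fin n × Fin n → (_ : Fin n) × Fin n :=
    ![fun z => ⟨z.1, z.2.1⟩, fun z => ⟨z.1, z.2.2⟩, fun z => ⟨z.2.1, z.1⟩,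
      fun z => ⟨z.2.2, z.1⟩, fun z => ⟨z.2.1, z.2.2⟩, fun z => ⟨z.2.2, z.2.1⟩]
  have hsub : Finset.univ.sigma (neighbors P σ) ⊆
      (Finset.univ : Finset (Fin 6)).biUnion fun c => T.image (f c) := by
    rintro ⟨i, j⟩ hz
    rw [Finset.mem_sigma, mem_neighbors] at hz
    obtain ⟨d, k, hd, hk⟩ := exists_isEnd_of_three_le (σ := σ) hP hn hz.2.1
    have hv := hk.vertex hP hσ0 hd hz.2
    have mem : ∀ (c : Fin 6) (m p q : Fin n) (a b : ℝ), Vertex P σ m p q a b →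
        height P t p < height P t m → height P t m < height P t q → f c (m, p, q) = ⟨i, j⟩ →
        (⟨i, j⟩ : (_ : Fin n) × Fin n) ∈
          (Finset.univ : Finset (Fin 6)).biUnion fun c => T.image (f c) := by
      intro c m p q a b h h1 h2 h3
      refine Finset.mem_biUnion.2 ⟨c, Finset.mem_univ _, Finset.mem_image.2 ⟨(m, p, q), ?_, h3⟩⟩
      simp only [T, Finset.mem_filter, Finset.mem_univ, true_and]
      exact ⟨⟨a, b, h⟩, h1, h2⟩
    have v1 := hv
    have v2 := hv.swap
    have v3 := hv.rotate
    have v4 := hv.rotate.swap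
    have v5 := hv.rotate.rotate
    have v6 := hv.rotate.rotate.swap
    -- Of the eight sign patterns two are cyclic and impossible; each of the others is one order of
    -- the three sites and selects its own map `f c`.
    rcases (ht.ne hv.ij).lt_or_gt with h1 | h1 <;> rcases (ht.ne hv.ik).lt_or_gt with h2 | h2 <;>
      rcases (ht.ne hv.jk).lt_or_gt with h3 | h3
    · exact mem 2 j i k _ _ v4 h1 h3 rfl
    · exact mem 4 k i j _ _ v5 h2 h3 rfl
    · linarith
    · exact mem 1 i k j _ _ v2 h2 h1 rfl
    · exact mem 0 i j k _ _ v1 h1 h2 rfl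
    · linarith
    · exact mem 5 k j i _ _ v6 h3 h2 rfl
    · exact mem 3 j k i _ _ v3 h3 h1 rfl
  calc ∑ i, (neighbors P σ i).card = (Finset.univ.sigma (neighbors P σ)).card :=
        (Finset.card_sigma _ _).symm
    _ ≤ _ := Finset.card_le_card hsub
    _ ≤ ∑ c : Fin 6, (T.image (f c)).card := Finset.card_biUnion_le
    _ ≤ ∑ _c : Fin 6, T.card := Finset.sum_le_sum fun c _ => Finset.card_image_le
    _ ≤ 12 * n := by simp; omega

end Counting

section Starts

variable {n : ℕ} {P : Sites n} {σ d : ℤ} {i j k w : Fin n}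

/-! ### The first edge of a cell -/

/-- The squared distance of two sites. -/
def sqDist (P : Sites n) (i k : Fin n) : ℤ :=
  (P.x k - P.x i) * (P.x k - P.x i) + (P.y k - P.y i) * (P.y k - P.y i)

theorem sqDist_nonneg (i k : Fin n) : 0 ≤ sqDist P i k :=
  add_nonneg (mul_self_nonneg _) (mul_self_nonneg _)

/-- Tests in the language have the form `0 < e`; this expresses that two indices differ. -/
theorem sqDist_pos_iff (hP : Generic P) : 0 < sqDist P i k ↔ i ≠ k := by
  constructor
  · rintro h rfl
    simp [sqDist] at h
  · intro h
    refine lt_of_le_of_ne (sqDist_nonneg i k) fun h0 => ?_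
    have h1 := mul_self_nonneg (P.x k - P.x i)
    have h2 := mul_self_nonneg (P.y k - P.y i)
    simp only [sqDist] at h0
    have hx := mul_self_eq_zero.1 (by linarith : (P.x k - P.x i) * (P.x k - P.x i) = 0)
    have hy := mul_self_eq_zero.1 (by linarith : (P.y k - P.y i) * (P.y k - P.y i) = 0)
    rcases hP.ne i k h with h | h
    · exact h (by linarith)
    · exact h (by linarith)

/-- The relation `0 < γ w k` ("`k` is better than `w`") is suitable for selecting a best index
among those with `0 < a k`. -/
def Selective {ι : Type} (a : ι → ℤ) (γ : ι → ι → ℤ) : Prop :=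
  (∀ k, 0 < a k → ¬ 0 < γ k k) ∧
    ∀ w m k, 0 < a w → 0 < a m → 0 < a k → 0 < γ w k → ¬ 0 < γ w m → ¬ 0 < γ k m

/-- The midpoint, `τ = 0`, is on the edge: by the law of cosines `2 * num P i w k` is at least
`sqDist P w k`. -/
theorem isEdge_of_nearest (hP : Generic P) (hw : 0 < sqDist P i w)
    (h : ∀ k, 0 < sqDist P i k → ¬ 0 < sqDist P i w - sqDist P i k) : IsEdge P 1 i w := by
  rw [isEdge_iff hP]
  refine ⟨(sqDist_pos_iff hP).1 hw, 0, fun k hki hkw => ?_⟩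
  have h1 := h k ((sqDist_pos_iff hP).2 hki.symm)
  have h2 : 0 < sqDist P w k := (sqDist_pos_iff hP).2 hkw.symm
  have h3 : 2 * num P i w k = sqDist P i k + sqDist P w k - sqDist P i w := by
    simp only [num, sqDist]; ring
  have h4 : 0 < num P i w k := by linarith
  simpa using h4

theorem selective_nearest (i : Fin n) :
    Selective (sqDist P i) fun w k => sqDist P i w - sqDist P i k := by
  refine ⟨fun k _ => by simp, fun w m k _ _ _ h1 h2 => ?_⟩
  linarith

/-- For a point of the farthest cell of `i`, all other sites lie in the open half-plane through `i`
that faces this point. Within it the angular order is linear. Without an edge the comparison may be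
cyclic, hence the hypothesis. -/
theorem selective_extreme (hP : Generic P) (h : IsEdge P (-1) i j) :
    Selective (sqDist P i) fun w k => det P i k w := by
  obtain ⟨hij, a, b, h1, h2⟩ := h
  have key : ∀ k, 0 < sqDist P i k →
      0 < (a - P.x i) * (P.x k - P.x i) + (b - P.y i) * (P.y k - P.y i) := by
    intro k hk
    have e1 : sq P k a b ≤ sq P i a b := by
      by_cases hkj : k = j
      · rw [hkj, h1]
      · have := h2 k ((sqDist_pos_iff hP).1 hk).symm hkj
        push_cast at this
        linarith
    have e2 : (0 : ℝ) < sqDist P i k := by exact_mod_cast hk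
    simp only [sq, sqDist] at e1 e2
    push_cast at e2
    linarith
  refine ⟨fun k _ => by simp [det_self], fun w m k hw hm hk h3 h4 h5 => ?_⟩
  have id : ((a - P.x i) * (P.x w - P.x i) + (b - P.y i) * (P.y w - P.y i)) * det P i m k =
      ((a - P.x i) * (P.x k - P.x i) + (b - P.y i) * (P.y k - P.y i)) * det P i m w -
      ((a - P.x i) * (P.x m - P.x i) + (b - P.y i) * (P.y m - P.y i)) * det P i k w := by
    simp only [det]; push_cast; ring
  have c3 : (0 : ℝ) < det P i k w := by exact_mod_cast h3
  have c4 : (det P i m w : ℝ) ≤ 0 := by exact_mod_cast not_lt.1 h4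
  have c5 : (0 : ℝ) < det P i m k := by exact_mod_cast h5
  have := mul_pos (key w hw) c5
  have := mul_nonneg (key k hk).le (neg_nonneg.2 c4)
  have := mul_pos (key m hm) c3
  linarith

/-- All other sites lie to the left of the line from `i` to `w`, so every constraint is a lower
bound for `τ`, and a large `τ` is feasible. -/
theorem isEdge_of_extreme (hP : Generic P) (hw : 0 < sqDist P i w)
    (h : ∀ k, 0 < sqDist P i k → ¬ 0 < det P i k w) : IsEdge P (-1) i w := by
  have hiw := (sqDist_pos_iff hP).1 hw
  rw [isEdge_iff hP]
  obtain ⟨B, hB⟩ := (Set.finite_range (par P i w)).bddAbove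
  refine ⟨hiw, B + 1, fun k hki hkw => ?_⟩
  have h1 : par P i w k ≤ B := hB ⟨k, rfl⟩
  have h2 : 0 < det P i w k := by
    have h3 := h k ((sqDist_pos_iff hP).2 hki.symm)
    rw [det_swap] at h3
    exact lt_of_le_of_ne (by linarith) (hP.det_ne i w k hiw hki.symm hkw.symm).symm
  have h4 : (0 : ℝ) < det P i w k := by exact_mod_cast h2
  have h5 : (num P i w k : ℝ) = par P i w k * det P i w k := (div_mul_cancel₀ _ h4.ne').symm
  rw [h5]
  have : ((-1 : ℤ) : ℝ) * (par P i w k * det P i w k - (B + 1) * det P i w k) =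
      (B + 1 - par P i w k) * det P i w k := by push_cast; ring
  rw [this]
  exact mul_pos (by linarith) h4

/-- The constraints on one side of an edge can be compared. -/
theorem selective_end (σ d : ℤ) (i j : Fin n) : Selective (fun k => d * det P i j k)
    fun w k => σ * d * (num P i j w * det P i j k - num P i j k * det P i j w) := by
  refine ⟨fun k _ => by simp [mul_comm], fun w m k hw hm hk h1 h2 h3 => ?_⟩
  have id : (d * det P i j w) *
        (σ * d * (num P i j k * det P i j m - num P i j m * det P i j k)) =
      (d * det P i j k) * (σ * d * (num P i j w * det P i j m - num P i j m * det P i j w)) -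
      (d * det P i j m) * (σ * d * (num P i j w * det P i j k - num P i j k * det P i j w)) := by
    ring
  have := mul_pos hw h3
  have := mul_nonneg hk.le (neg_nonneg.2 (not_lt.1 h2))
  have := mul_pos hm h1
  linarith

end Starts

/-! ### Rules for commands -/

section Rules

variable {n : ℕ} {P : Sites n}

/-- The command leads from `s`, at cost at most `T`, to a store with the property `Q`. -/
def Reaches (P : Sites n) (c : Cmd) (T : ℕ) (s : Store n) (Q : Store n → Prop) : Prop :=
  ∃ s' t, Exec P c s s' t ∧ t ≤ T ∧ Q s'

variable {c c₁ c₂ : Cmd} {T T₁ T₂ : ℕ} {s : Store n} {Q Q' : Store n → Prop} {e : Expr}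

theorem Reaches.mono (h : Reaches P c T s Q) (hT : T ≤ T₁) (hQ : ∀ s, Q s → Q' s) :
    Reaches P c T₁ s Q' := by
  obtain ⟨s', t, h1, h2, h3⟩ := h
  exact ⟨s', t, h1, h2.trans hT, hQ _ h3⟩

theorem reaches_skip (h : Q s) : Reaches P .skip 0 s Q := ⟨s, 0, .skip s, le_rfl, h⟩

theorem reaches_copy {x y : ℕ} (h : Q (s.set x (s.var y))) : Reaches P (.copy x y) 1 s Q :=
  ⟨_, 1, .copy x y s, le_rfl, h⟩

theorem reaches_report {r : EdgeRecord Expr}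
    (h : Q ⟨s.var, s.out ++ [r.map (Expr.eval P s.var)]⟩) : Reaches P (.report r) 1 s Q :=
  ⟨_, 1, .report r s, le_rfl, h⟩

theorem Reaches.seq (h : Reaches P c₁ T₁ s fun s' => Reaches P c₂ T₂ s' Q) :
    Reaches P (.seq c₁ c₂) (T₁ + T₂) s Q := by
  obtain ⟨s', t, h1, h2, s'', t', h3, h4, h5⟩ := h
  exact ⟨s'', t + t', .seq h1 h3, by omega, h5⟩

theorem reaches_ite (h₁ : 0 < e.eval P s.var → Reaches P c₁ T s Q)
    (h₂ : ¬ 0 < e.eval P s.var → Reaches P c₂ T s Q) : Reaches P (.ite e c₁ c₂) (T + 1) s Q := by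
  by_cases h : 0 < e.eval P s.var
  · obtain ⟨s', t, h1, h2, h3⟩ := h₁ h
    exact ⟨s', t + 1, .ite_pos h h1, by omega, h3⟩
  · obtain ⟨s', t, h1, h2, h3⟩ := h₂ h
    exact ⟨s', t + 1, .ite_neg h h1, by omega, h3⟩

theorem reaches_loop_done (h : ¬ 0 < e.eval P s.var) (hQ : Q s) : Reaches P (.loop e c) 1 s Q :=
  ⟨s, 1, .loop_done h, le_rfl, hQ⟩

theorem reaches_loop_step (h : 0 < e.eval P s.var)
    (h' : Reaches P c T₁ s fun s' => Reaches P (.loop e c) T₂ s' Q) :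
    Reaches P (.loop e c) (T₁ + T₂ + 1) s Q := by
  obtain ⟨s', t, h1, h2, s'', t', h3, h4, h5⟩ := h'
  exact ⟨s'', t + t' + 1, .loop_step h h1 h3, by omega, h5⟩

theorem reaches_all {x : ℕ} (I : ℕ → Store n → Prop) (T : ℕ → ℕ) (h0 : I 0 s)
    (hstep : ∀ (j : Fin n) (s : Store n), I j s →
      Reaches P c (T j) (s.set x j) fun s' => s'.var x = j ∧ I (j + 1) s')
    (z : Fin n) (hz : (z : ℕ) = 0) (hQ : ∀ s, I n s → Q (s.set x z)) :
    Reaches P (.all x c) (∑ j ∈ Finset.range n, (T j + 1) + 1) s Q := by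
  -- Made total, with an arbitrary value where `j` is out of range or the invariant fails, so that
  -- the sequence of stores can be defined by recursion.
  have hex : ∀ (j : ℕ) (s : Store n), ∃ (s' : Store n) (t : ℕ), ∀ hj : j < n, I j s →
      Exec P c (s.set x ⟨j, hj⟩) s' t ∧ t ≤ T j ∧ s'.var x = ⟨j, hj⟩ ∧ I (j + 1) s' := by
    intro j s
    by_cases hj : j < n
    · by_cases hI : I j s
      · obtain ⟨s', t, h1, h2, h3, h4⟩ := hstep ⟨j, hj⟩ s hI
        exact ⟨s', t, fun _ _ => ⟨h1, h2, h3, h4⟩⟩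
      · exact ⟨s, 0, fun _ h => absurd h hI⟩
    · exact ⟨s, 0, fun h => absurd h hj⟩
  choose F t hF using hex
  let S : ℕ → Store n := fun j => Nat.rec s (fun j s => F j s) j
  have hI : ∀ j ≤ n, I j (S j) := by
    intro j
    induction j with
    | zero => exact fun _ => h0
    | succ j ih => exact fun hj => (hF j (S j) hj (ih (by omega))).2.2.2
  refine ⟨(S n).set x z, _, .all S (fun j => t j (S j)) z hz (fun i => ?_) (fun i => ?_), ?_,
    hQ _ (hI n le_rfl)⟩
  · exact (hF i (S i) i.2 (hI i i.2.le)).1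
  · exact (hF i (S i) i.2 (hI i i.2.le)).2.2.1
  · refine Nat.add_le_add_right (Finset.sum_le_sum fun j hj => ?_) 1
    have hj := Finset.mem_range.1 hj
    exact Nat.add_le_add_right (hF j (S j) hj (hI j hj.le)).2.1 1

end Rules

/-! ### The program -/

namespace Expr

def det (i j k : ℕ) : Expr :=
  sub (mul (sub (X j) (X i)) (sub (Y k) (Y i))) (mul (sub (Y j) (Y i)) (sub (X k) (X i)))

def num (i j k : ℕ) : Expr :=
  add (mul (sub (X k) (X i)) (sub (X k) (X j))) (mul (sub (Y k) (Y i)) (sub (Y k) (Y j)))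

def sqDist (i k : ℕ) : Expr :=
  add (mul (sub (X k) (X i)) (sub (X k) (X i))) (mul (sub (Y k) (Y i)) (sub (Y k) (Y i)))

/-- Compares the bounds `par` of `v` and `k` without division. It serves both the search for an end
and the edge test. -/
def compare (σd : ℤ) (i j v k : ℕ) : Expr :=
  mul (const σd) (sub (mul (num i j v) (det i j k)) (mul (num i j k) (det i j v)))

def endX (d : ℤ) (i j e : ℕ) : Expr :=
  mul (const d) (sub (mul (det i j e) (add (X i) (X j))) (mul (num i j e) (sub (Y j) (Y i))))

def endY (d : ℤ) (i j e : ℕ) : Expr :=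
  mul (const d) (add (mul (det i j e) (add (Y i) (Y j))) (mul (num i j e) (sub (X j) (X i))))

def endW (d : ℤ) (i j e : ℕ) : Expr := mul (const 2) (mul (const d) (det i j e))

end Expr

def Expr.segmentRecord (d : ℤ) (i j e g : ℕ) : EdgeRecord Expr :=
  ⟨.idx i, .idx j, .endX d i j e, .endY d i j e, .endW d i j e,
    .endX (-d) i j g, .endY (-d) i j g, .endW (-d) i j g⟩

def Expr.halflineRecord (σ d : ℤ) (i j e : ℕ) : EdgeRecord Expr :=
  ⟨.idx i, .idx j, .endX d i j e, .endY d i j e, .endW d i j e,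
    .mul (.const (σ * d)) (.sub (.Y j) (.Y i)), .mul (.const (σ * d)) (.sub (.X i) (.X j)),
    .const 0⟩

namespace Cmd

/-- Selects in the variable `v` a best index; `A₁`, `A₂` tell whether the indices in the variable
`5` and in `v` qualify, and `G` whether the former is better. -/
def select (v : ℕ) (A₁ A₂ G : Expr) : Cmd :=
  all 5 (ite A₁ (ite A₂ (ite G (copy v 5) skip) (copy v 5)) skip)

/-- Stores in `v` the site that bounds, on the side `d`, the edge for the sites in the variables
`0` and `2`. -/
def findEnd (σ d : ℤ) (v : ℕ) : Cmd :=
  seq (copy v 2) (select v (.mul (.const d) (.det 0 2 5)) (.mul (.const d) (.det 0 2 v))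
    (.compare (σ * d) 0 2 v 5))

def findEnds (σ d : ℤ) : Cmd := seq (findEnd σ d 3) (findEnd σ (-d) 4)

/-- Reports the edge for the sites in the variables `0` and `2`, whose ends are given by `3` and
`4`, if it has not to be reported with the two sites interchanged. -/
def reportEdge (σ d : ℤ) : Cmd :=
  ite (.sub (.idx 2) (.idx 0))
    (ite (.mul (.const d) (.det 0 2 3))
      (ite (.mul (.const (-d)) (.det 0 2 4))
        (report (Expr.segmentRecord d 0 2 3 4))
        (report (Expr.halflineRecord σ d 0 2 3)))
      (report (Expr.halflineRecord σ (-d) 0 2 4)))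
    skip

/-- Walks along the boundary of the cell of `0` in direction `d`, within a half-plane given by the
first edge `1`. -/
def walk (σ d : ℤ) : Cmd :=
  loop (.mul (.det 0 1 3) (.det 0 2 3))
    (seq (copy 2 3) (seq (findEnds σ d) (reportEdge σ d)))

/-- The first walk overwrites variables `2` and `3`. Variable `1` keeps the first edge, from which
the end for the opposite direction is found again. -/
def walkBoth (σ : ℤ) : Cmd :=
  seq (reportEdge σ 1) (seq (walk σ 1) (seq (copy 2 1) (seq (findEnd σ (-1) 3) (walk σ (-1)))))

/-- Reports the edges of the cell of `0`; the first one is found by a selection with `G`. -/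
def cell (σ : ℤ) (G : Expr) : Cmd :=
  seq (copy 1 0) (seq (select 1 (.sqDist 0 5) (.sqDist 0 1) G)
    (seq (copy 2 1) (seq (findEnds σ 1)
      (ite (.mul (.const (-1)) (.mul (.det 0 2 3) (.det 0 2 4)))
        (ite (.compare σ 0 2 4 3) (walkBoth σ) skip)
        (walkBoth σ)))))

def diagram (σ : ℤ) (G : Expr) : Cmd := all 0 (cell σ G)

end Cmd


section Correctness

variable {n : ℕ} {P : Sites n} {σ d : ℤ} {s : Store n}

/-! ### Correctness of the program -/

theorem Store.set_var_of_ne (s : Store n) {x y : ℕ} (h : y ≠ x) (i : Fin n) :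
    (s.set x i).var y = s.var y := Function.update_of_ne h _ _

theorem Store.set_var_self (s : Store n) (x : ℕ) (i : Fin n) : (s.set x i).var x = i :=
  Function.update_self _ _ _

/-- `Selective` is a premise only of optimality: a scan with a cyclic comparison still ends with a
qualifying index. This matters for farthest-site cells without edges. -/
theorem reaches_select {v : ℕ} {A₁ A₂ G : Expr} (hv : v ≠ 5) (hn : 0 < n) (a : Fin n → ℤ)
    (γ : Fin n → Fin n → ℤ)
    (hA : ∀ u : ℕ → Fin n, (∀ x, x ≠ v → x ≠ 5 → u x = s.var x) →
      A₁.eval P u = a (u 5) ∧ A₂.eval P u = a (u v) ∧ G.eval P u = γ (u v) (u 5)) :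
    Reaches P (.select v A₁ A₂ G) (5 * n + 1) s fun s' => s'.out = s.out ∧
      (∀ x, x ≠ v → x ≠ 5 → s'.var x = s.var x) ∧
      ((s'.var v = s.var v ∧ ∀ k, ¬ 0 < a k) ∨
        (0 < a (s'.var v) ∧ (Selective a γ → ∀ k, 0 < a k → ¬ 0 < γ (s'.var v) k))) := by
  have hsum : ∑ j ∈ Finset.range n, ((fun _ => 4) j + 1) + 1 = 5 * n + 1 := by
    simp [mul_comm]
  rw [Cmd.select, ← hsum]
  refine reaches_all (fun j s' => s'.out = s.out ∧
      (∀ x, x ≠ v → x ≠ 5 → s'.var x = s.var x) ∧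
      ((s'.var v = s.var v ∧ ∀ k : Fin n, (k : ℕ) < j → ¬ 0 < a k) ∨
        (0 < a (s'.var v) ∧ (Selective a γ → ∀ k : Fin n, (k : ℕ) < j → 0 < a k →
          ¬ 0 < γ (s'.var v) k)))) _ ⟨rfl, fun _ _ _ => rfl, .inl ⟨rfl, fun k hk => by omega⟩⟩ ?_
    ⟨0, hn⟩ rfl ?_
  · rintro j s₁ ⟨ho, hx, hI⟩
    have hset : ∀ x, x ≠ v → x ≠ 5 → (s₁.set 5 j).var x = s.var x := fun x h1 h2 => by
      rw [Store.set_var_of_ne _ h2]; exact hx x h1 h2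
    obtain ⟨e1, e2, e3⟩ := hA (s₁.set 5 j).var hset
    have h5 : (s₁.set 5 j).var 5 = j := by simp [Store.set]
    have hvv : (s₁.set 5 j).var v = s₁.var v := by simp [Store.set, hv]
    have hlt : ∀ k : Fin n, (k : ℕ) < j + 1 ↔ (k : ℕ) < j ∨ k = j := fun k => by
      rw [Nat.lt_succ_iff_lt_or_eq, Fin.ext_iff]
    have hcopy : ((s₁.set 5 j).set v ((s₁.set 5 j).var 5)).var v = j := by
      simp [Store.set]
    have hcopy5 : ((s₁.set 5 j).set v ((s₁.set 5 j).var 5)).var 5 = j := by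
      simp [Store.set, hv.symm]
    have hcopyx : ∀ x, x ≠ v → x ≠ 5 →
        ((s₁.set 5 j).set v ((s₁.set 5 j).var 5)).var x = s.var x := fun x h1 h2 => by
      rw [Store.set_var_of_ne _ h1]; exact hset x h1 h2
    rw [h5] at e1 e3
    rw [hvv] at e2 e3
    refine (reaches_ite (T := 3) (fun c1 => reaches_ite (T := 2) (fun c2 => reaches_ite (T := 1)
      (fun c3 => reaches_copy ?_) fun c3 => (reaches_skip ?_).mono (by omega) fun _ h => h)
      fun c2 => (reaches_copy ?_).mono (by omega) fun _ h => h)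
      fun c1 => (reaches_skip ?_).mono (by omega) fun _ h => h)
    · rw [e1] at c1
      rw [e2] at c2
      rw [e3] at c3
      refine ⟨hcopy5, ho, hcopyx, .inr ?_⟩
      rw [hcopy]
      refine ⟨c1, fun hs k hk hak => ?_⟩
      rcases (hlt k).1 hk with hk | rfl
      · rcases hI with ⟨h, h'⟩ | ⟨-, h⟩
        · exact absurd hak (h' k hk)
        · exact hs.2 _ k j c2 hak c1 c3 (h hs k hk hak)
      · exact hs.1 _ c1
    · rw [e1] at c1
      rw [e2] at c2
      rw [e3] at c3
      refine ⟨h5, ho, hset, .inr ?_⟩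
      rw [hvv]
      refine ⟨c2, fun hs k hk hak => ?_⟩
      rcases (hlt k).1 hk with hk | rfl
      · rcases hI with ⟨h, h'⟩ | ⟨-, h⟩
        · exact absurd hak (h' k hk)
        · exact h hs k hk hak
      · exact c3
    · rw [e1] at c1
      rw [e2] at c2
      refine ⟨hcopy5, ho, hcopyx, .inr ?_⟩
      rw [hcopy]
      refine ⟨c1, fun hs k hk hak => ?_⟩
      rcases (hlt k).1 hk with hk | rfl
      · rcases hI with ⟨h, h'⟩ | ⟨h, -⟩
        · exact absurd hak (h' k hk)
        · exact absurd h c2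
      · exact hs.1 _ c1
    · rw [e1] at c1
      refine ⟨h5, ho, hset, ?_⟩
      rw [hvv]
      refine hI.imp (fun h => ⟨h.1, fun k hk => ?_⟩) fun h => ⟨h.1, fun hs k hk hak => ?_⟩
      · rcases (hlt k).1 hk with hk | rfl
        · exact h.2 k hk
        · exact c1
      · rcases (hlt k).1 hk with hk | rfl
        · exact h.2 hs k hk hak
        · exact absurd hak c1
  · rintro s₁ ⟨ho, hx, hI⟩
    have hvv : (s₁.set 5 ⟨0, hn⟩).var v = s₁.var v := by simp [Store.set, hv]
    refine ⟨ho, fun x h1 h2 => ?_, ?_⟩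
    · rw [Store.set_var_of_ne _ h2]; exact hx x h1 h2
    · rw [hvv]
      exact hI.imp (fun h => ⟨h.1, fun k => h.2 k k.2⟩) fun h => ⟨h.1, fun hs k => h.2 hs k k.2⟩

theorem reaches_findEnd {v : ℕ} (hv : v = 3 ∨ v = 4) (hn : 0 < n) :
    Reaches P (.findEnd σ d v) (5 * n + 2) s fun s' => s'.out = s.out ∧
      (∀ x, x ≠ v → x ≠ 5 → s'.var x = s.var x) ∧
      EndSpec P σ d (s.var 0) (s.var 2) (s'.var v) := by
  have hT : 5 * n + 2 = 1 + (5 * n + 1) := by omega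
  rw [Cmd.findEnd, hT]
  -- Starting from the second site of the pair, where `det` vanishes and which hence does not
  -- qualify, encodes "nothing found yet".
  refine (reaches_copy ?_).seq
  have hx : ∀ x, x ≠ v → (s.set v (s.var 2)).var x = s.var x := fun x h => by
    rw [Store.set_var_of_ne _ h]
  have hself : (s.set v (s.var 2)).var v = s.var 2 := by simp [Store.set]
  refine (reaches_select (by omega) hn (fun k => d * det P (s.var 0) (s.var 2) k)
    (fun w k => σ * d * (num P (s.var 0) (s.var 2) w * det P (s.var 0) (s.var 2) k -
      num P (s.var 0) (s.var 2) k * det P (s.var 0) (s.var 2) w)) fun u hu => ?_).mono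
    le_rfl ?_
  · have h0 : u 0 = s.var 0 := (hu 0 (by omega) (by omega)).trans (hx 0 (by omega))
    have h2 : u 2 = s.var 2 := (hu 2 (by omega) (by omega)).trans (hx 2 (by omega))
    rw [← h0, ← h2]
    exact ⟨rfl, rfl, rfl⟩
  · rintro s' ⟨h1, h2, h3⟩
    refine ⟨h1, fun x hv h5 => (h2 x hv h5).trans (hx x hv), ?_⟩
    rw [hself] at h3
    exact h3.imp id fun h => ⟨h.1, h.2 (selective_end _ _ _ _)⟩

theorem reaches_findEnds (hn : 0 < n) :
    Reaches P (.findEnds σ d) (10 * n + 4) s fun s' => s'.out = s.out ∧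
      s'.var 0 = s.var 0 ∧ s'.var 1 = s.var 1 ∧ s'.var 2 = s.var 2 ∧
      EndSpec P σ d (s.var 0) (s.var 2) (s'.var 3) ∧
      EndSpec P σ (-d) (s.var 0) (s.var 2) (s'.var 4) := by
  have hT : 10 * n + 4 = (5 * n + 2) + (5 * n + 2) := by omega
  rw [Cmd.findEnds, hT]
  refine ((reaches_findEnd (.inl rfl) hn).mono le_rfl ?_).seq
  rintro s₁ ⟨h1, h2, h3⟩
  refine (reaches_findEnd (.inr rfl) hn).mono le_rfl ?_
  rintro s₂ ⟨k1, k2, k3⟩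
  have e0 := h2 0 (by omega) (by omega)
  have e2 := h2 2 (by omega) (by omega)
  rw [e0, e2] at k3
  refine ⟨k1.trans h1, (k2 0 (by omega) (by omega)).trans e0,
    (k2 1 (by omega) (by omega)).trans (h2 1 (by omega) (by omega)),
    (k2 2 (by omega) (by omega)).trans e2, ?_, k3⟩
  rw [k2 3 (by omega) (by omega)]
  exact h3

/-! ### Bookkeeping for the output -/

/-- The list consists of records of the edges in `S`, one of each. -/
structure Lists (P : Sites n) (σ : ℤ) (S : Set (Fin n × Fin n)) (L : List (EdgeRecord ℤ)) :
    Prop where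
  sound : ∀ r ∈ L, ∃ z ∈ S, r.site₁ = (z.1 : ℕ) ∧ r.site₂ = (z.2 : ℕ) ∧ 0 < r.w₁ ∧ 0 ≤ r.w₂ ∧
    r.carrier = edgeSet P σ z.1 z.2
  complete : ∀ z ∈ S, ∃ r ∈ L, r.site₁ = (z.1 : ℕ) ∧ r.site₂ = (z.2 : ℕ)
  nodup : (L.map fun r => (r.site₁, r.site₂)).Nodup

theorem Lists.nil : Lists P σ ∅ [] := ⟨by simp, by simp, by simp⟩

theorem Lists.append {S S' : Set (Fin n × Fin n)} {L L' : List (EdgeRecord ℤ)}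
    (h : Lists P σ S L) (h' : Lists P σ S' L') (hd : Disjoint S S') :
    Lists P σ (S ∪ S') (L ++ L') where
  sound r hr := by
    rcases List.mem_append.1 hr with hr | hr
    · obtain ⟨z, hz, h⟩ := h.sound r hr
      exact ⟨z, .inl hz, h⟩
    · obtain ⟨z, hz, h⟩ := h'.sound r hr
      exact ⟨z, .inr hz, h⟩
  complete z hz := by
    rcases hz with hz | hz
    · obtain ⟨r, hr, h⟩ := h.complete z hz
      exact ⟨r, List.mem_append_left _ hr, h⟩
    · obtain ⟨r, hr, h⟩ := h'.complete z hz
      exact ⟨r, List.mem_append_right _ hr, h⟩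
  nodup := by
    rw [List.map_append, List.nodup_append']
    refine ⟨h.nodup, h'.nodup, fun p hp hp' => ?_⟩
    obtain ⟨r, hr, rfl⟩ := List.mem_map.1 hp
    obtain ⟨r', hr', he⟩ := List.mem_map.1 hp'
    obtain ⟨z, hz, e1, e2, -⟩ := h.sound r hr
    obtain ⟨z', hz', e1', e2', -⟩ := h'.sound r' hr'
    simp only [e1, e2, e1', e2', Prod.mk.injEq, Nat.cast_inj, Fin.val_inj] at he
    exact Set.disjoint_left.1 hd hz (by rwa [← Prod.ext he.1 he.2])

/-- The pairs `(i, j)` with `i < j` and `j ∈ A`. -/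
def pairsAbove (i : Fin n) (A : Set (Fin n)) : Set (Fin n × Fin n) :=
  {z | z.1 = i ∧ z.2 ∈ A ∧ i < z.2}

theorem pairsAbove_union (i : Fin n) (A B : Set (Fin n)) :
    pairsAbove i (A ∪ B) = pairsAbove i A ∪ pairsAbove i B := by
  ext z
  simp only [pairsAbove, Set.mem_union, Set.mem_ofPred_eq]
  tauto

theorem pairsAbove_empty (i : Fin n) : pairsAbove i ∅ = ∅ := by
  ext z
  simp [pairsAbove]

theorem Lists.pairsAbove_append {i : Fin n} {A B : Set (Fin n)} {L L' : List (EdgeRecord ℤ)}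
    (h : Lists P σ (pairsAbove i A) L) (h' : Lists P σ (pairsAbove i B) L') (hd : Disjoint A B) :
    Lists P σ (pairsAbove i (A ∪ B)) (L ++ L') := by
  rw [pairsAbove_union]
  exact h.append h' (Set.disjoint_left.2 fun z hz hz' =>
    Set.disjoint_left.1 hd hz.2.1 hz'.2.1)

theorem Lists.singleton {i j : Fin n} {r : EdgeRecord ℤ} (hij : i < j) (h1 : r.site₁ = (i : ℕ))
    (h2 : r.site₂ = (j : ℕ)) (h3 : 0 < r.w₁) (h4 : 0 ≤ r.w₂) (h5 : r.carrier = edgeSet P σ i j) :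
    Lists P σ (pairsAbove i {j}) [r] where
  sound r' hr := by
    rw [List.mem_singleton] at hr
    subst hr
    exact ⟨(i, j), ⟨rfl, rfl, hij⟩, h1, h2, h3, h4, h5⟩
  complete z hz := by
    obtain ⟨e1, e2, -⟩ := hz
    exact ⟨r, by simp, by rw [e1, h1], by rw [e2, h2]⟩
  nodup := by simp

theorem reaches_reportEdge (hP : Generic P) (hn : 3 ≤ n) (hσ : σ = 1 ∨ σ = -1)
    (hd : d = 1 ∨ d = -1) (h : IsEdge P σ (s.var 0) (s.var 2))
    (he : EndSpec P σ d (s.var 0) (s.var 2) (s.var 3))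
    (hg : EndSpec P σ (-d) (s.var 0) (s.var 2) (s.var 4)) :
    Reaches P (.reportEdge σ d) 4 s fun s' => s'.var = s.var ∧ ∃ L, s'.out = s.out ++ L ∧
      Lists P σ (pairsAbove (s.var 0) {s.var 2}) L := by
  have hlt : 0 < (Expr.sub (.idx 2) (.idx 0)).eval P s.var ↔ s.var 0 < s.var 2 := by
    simp only [Expr.eval]
    rw [Fin.lt_def]; omega
  have hw : ∀ {d : ℤ} {e : Fin n}, 0 < d * det P (s.var 0) (s.var 2) e →
      0 < endW P d (s.var 0) (s.var 2) e := by
    intro d e h; simp only [endW]; omega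
  refine reaches_ite (T := 3) (fun h1 => reaches_ite (T := 2) (fun h2 => reaches_ite (T := 1)
      (fun h3 => reaches_report ⟨rfl, _, rfl, ?_⟩) fun h3 => reaches_report ⟨rfl, _, rfl, ?_⟩)
      fun h2 => (reaches_report ⟨rfl, _, rfl, ?_⟩).mono (by omega) fun _ h => h)
      fun h1 => (reaches_skip ⟨rfl, [], by simp, ?_⟩).mono (by omega) fun _ h => h
  · exact Lists.singleton (hlt.1 h1) rfl rfl (hw h2) (hw h3).le
      (carrier_segmentRecord hP hd h (he.isEnd h2) (hg.isEnd h3))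
  · exact Lists.singleton (hlt.1 h1) rfl rfl (hw h2) le_rfl
      (carrier_halflineRecord hP hσ hd h (he.isEnd h2) (hg.resolve_right fun h => h3 h.1).2)
  · have hne : ∀ l, ¬ 0 < d * det P (s.var 0) (s.var 2) l :=
      (he.resolve_right fun h => h2 h.1).2
    -- No site lies on the side `d`, so the third site provides an end on the other side.
    have h3 : 0 < -d * det P (s.var 0) (s.var 2) (s.var 4) := by
      obtain ⟨d', k, hd', hk⟩ := exists_isEnd_of_three_le (σ := σ) hP hn h.1
      have hd'' : d' = -d := by
        by_contra hne'
        have : d' = d := by rcases hd with rfl | rfl <;> rcases hd' with rfl | rfl <;> simp_all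
        exact hne k (this ▸ hk.1)
      exact (hg.isEnd (hd'' ▸ hk.1)).1
    refine Lists.singleton (hlt.1 h1) rfl rfl (hw h3) le_rfl
      (carrier_halflineRecord hP hσ (neg_one_or hd) h (hg.isEnd h3)
        fun l => by simpa [Expr.eval] using hne l)
  · have : pairsAbove (s.var 0) {s.var 2} = ∅ := by
      ext z
      simp only [pairsAbove, Set.mem_singleton_iff, Set.mem_ofPred_eq, Set.mem_empty_iff_false,
        iff_false]
      rintro ⟨-, h3, h4⟩
      exact h1 (hlt.2 (h3 ▸ h4))
    rw [this]
    exact Lists.nil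

/-- Induction on the number of neighbours still ahead: a round costs at most `10 * n + 10`, by its
two scans, and lowers this number by one. -/
theorem reaches_walk (hP : Generic P) (hn : 3 ≤ n) (hσ : σ = 1 ∨ σ = -1)
    (hd : d = 1 ∨ d = -1) (h : IsEdge P σ (s.var 0) (s.var 2))
    (hs : s.var 2 = s.var 1 ∨ 0 < d * det P (s.var 0) (s.var 1) (s.var 2))
    (he : EndSpec P σ d (s.var 0) (s.var 2) (s.var 3)) :
    Reaches P (.walk σ d)
      ((10 * n + 10) * (After P σ d (s.var 0) (s.var 1) (s.var 2)).ncard + 1) s fun s' =>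
        s'.var 0 = s.var 0 ∧ s'.var 1 = s.var 1 ∧ ∃ L, s'.out = s.out ++ L ∧
          Lists P σ (pairsAbove (s.var 0) (After P σ d (s.var 0) (s.var 1) (s.var 2))) L := by
  have hσ0 : σ ≠ 0 := by rcases hσ with rfl | rfl <;> norm_num
  have hdd : d * d = 1 := by rcases hd with rfl | rfl <;> norm_num
  generalize hm : (After P σ d (s.var 0) (s.var 1) (s.var 2)).ncard = m
  induction m using Nat.strong_induction_on generalizing s with
  | _ m ih =>
  by_cases hc : 0 < (Expr.mul (.det 0 1 3) (.det 0 2 3)).eval P s.var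
  · have hc' : 0 < det P (s.var 0) (s.var 1) (s.var 3) * det P (s.var 0) (s.var 2) (s.var 3) := hc
    have hend : IsEnd P σ d (s.var 0) (s.var 2) (s.var 3) := by
      refine he.resolve_left fun h => ?_
      rw [h.1, det_self] at hc'
      simp at hc'
    -- The second factor of the loop test has the sign `d` if there is an end and is zero otherwise.
    -- So the product tests at once that an end exists and that it lies in the half-plane.
    have hse : 0 < d * det P (s.var 0) (s.var 1) (s.var 3) := by
      refine pos_of_mul_pos_left (b := d * det P (s.var 0) (s.var 2) (s.var 3)) ?_ hend.1.le
      have : d * det P (s.var 0) (s.var 1) (s.var 3) *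
          (d * det P (s.var 0) (s.var 2) (s.var 3)) = det P (s.var 0) (s.var 1) (s.var 3) *
          det P (s.var 0) (s.var 2) (s.var 3) := by
        linear_combination (det P (s.var 0) (s.var 1) (s.var 3) *
          det P (s.var 0) (s.var 2) (s.var 3)) * hdd
      rwa [this]
    have hA := After.eq_insert hP hσ hd h hs hend hse
    have hcard : (After P σ d (s.var 0) (s.var 1) (s.var 3)).ncard + 1 = m := by
      rw [← hm, hA, Set.ncard_insert_of_notMem After.notMem_self (Set.toFinite _)]
    have hedge : IsEdge P σ (s.var 0) (s.var 3) := (hend.vertex hP hσ0 hd h).isEdge hP hσ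
    have hT : (10 * n + 10) * m + 1 = (1 + ((10 * n + 4) + 4)) +
        ((10 * n + 10) * (After P σ d (s.var 0) (s.var 1) (s.var 3)).ncard + 1) + 1 := by
      rw [← hcard]; ring
    rw [hT]
    refine reaches_loop_step hc ((reaches_copy ((reaches_findEnds (by omega)).mono le_rfl
      ?_).seq).seq)
    rintro s₁ ⟨o1, v0, v1, v2, he1, hg1⟩
    rw [Store.set_var_of_ne _ (by omega)] at v0 v1 he1 hg1
    rw [Store.set_var_self] at v2 he1 hg1
    refine (reaches_reportEdge hP hn hσ hd (by rw [v0, v2]; exact hedge)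
      (by rw [v0, v2]; exact he1) (by rw [v0, v2]; exact hg1)).mono le_rfl ?_
    rintro s₂ ⟨hv, L₁, o2, hL₁⟩
    rw [v0, v2] at hL₁
    rw [← hv] at v0 v1 v2 he1
    have := ih (After P σ d (s.var 0) (s.var 1) (s.var 3)).ncard (by omega) (s := s₂) (by rw [v0, v2]; exact hedge)
      (by rw [v0, v1, v2]; exact .inr hse) (by rw [v0, v2]; exact he1)
      (by rw [v0, v1, v2])
    refine this.mono le_rfl ?_
    rintro s₃ ⟨w0, w1, L₂, o3, hL₂⟩
    rw [v0, v1, v2] at hL₂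
    refine ⟨w0.trans v0, w1.trans v1, L₁ ++ L₂, ?_, ?_⟩
    · rw [o3, o2, o1, List.append_assoc]; rfl
    · rw [hA, Set.insert_eq]
      exact hL₁.pairsAbove_append hL₂ (Set.disjoint_singleton_left.2 After.notMem_self)
  · have hA : After P σ d (s.var 0) (s.var 1) (s.var 2) = ∅ := by
      refine After.eq_empty hP hσ hd h hs (he.imp (fun h => h.2) fun h' => ⟨h', fun hse => hc ?_⟩)
      have h1 := mul_pos hse h'.1
      have : d * det P (s.var 0) (s.var 1) (s.var 3) *
          (d * det P (s.var 0) (s.var 2) (s.var 3)) = det P (s.var 0) (s.var 1) (s.var 3) *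
          det P (s.var 0) (s.var 2) (s.var 3) := by
        linear_combination (det P (s.var 0) (s.var 1) (s.var 3) *
          det P (s.var 0) (s.var 2) (s.var 3)) * hdd
      rwa [this] at h1
    refine (reaches_loop_done hc ⟨rfl, rfl, [], by simp, ?_⟩).mono (by omega) fun _ h => h
    rw [hA, pairsAbove_empty]
    exact Lists.nil

theorem edges_eq_union (hP : Generic P) {i j : Fin n} (h : IsEdge P σ i j) :
    {l | IsEdge P σ i l} = {j} ∪ (After P σ 1 i j j ∪ After P σ (-1) i j j) := by
  ext l
  simp only [After, Set.mem_ofPred_eq, Set.mem_union, Set.mem_singleton_iff]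
  constructor
  · intro hl
    by_cases hlj : l = j
    · exact .inl hlj
    · rcases sign_det_or (d := 1) hP (.inl rfl) h.1 hl.1.symm hlj with h | h
      · exact .inr (.inl ⟨hl, h, h⟩)
      · exact .inr (.inr ⟨hl, by linarith, by linarith⟩)
  · rintro (rfl | h | h)
    · exact h
    · exact h.1
    · exact h.1

theorem disjoint_after (i j : Fin n) :
    Disjoint (After P σ 1 i j j) (After P σ (-1) i j j) :=
  Set.disjoint_left.2 fun l h h' => by
    have := h.2.1
    have := h'.2.1
    omega

theorem reaches_walkBoth (hP : Generic P) (hn : 3 ≤ n) (hσ : σ = 1 ∨ σ = -1)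
    (h : IsEdge P σ (s.var 0) (s.var 1)) (h2 : s.var 2 = s.var 1)
    (he : EndSpec P σ 1 (s.var 0) (s.var 1) (s.var 3))
    (hg : EndSpec P σ (-1) (s.var 0) (s.var 1) (s.var 4)) :
    Reaches P (.walkBoth σ) ((10 * n + 10) * (neighbors P σ (s.var 0)).card) s fun s' =>
      s'.var 0 = s.var 0 ∧ ∃ L, s'.out = s.out ++ L ∧
        Lists P σ (pairsAbove (s.var 0) {l | IsEdge P σ (s.var 0) l}) L := by
  have hU := edges_eq_union hP h
  have hcard : (neighbors P σ (s.var 0)).card = 1 +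
      ((After P σ 1 (s.var 0) (s.var 1) (s.var 1)).ncard +
        (After P σ (-1) (s.var 0) (s.var 1) (s.var 1)).ncard) := by
    have h1 : {l | IsEdge P σ (s.var 0) l} = (neighbors P σ (s.var 0) : Set (Fin n)) := by
      ext l; simp [mem_neighbors]
    have h3 : Disjoint {s.var 1} (After P σ 1 (s.var 0) (s.var 1) (s.var 1) ∪
        After P σ (-1) (s.var 0) (s.var 1) (s.var 1)) := by
      rw [Set.disjoint_singleton_left, Set.mem_union]
      exact fun h => h.elim After.notMem_self After.notMem_self
    rw [← Set.ncard_coe_finset, ← h1, hU, Set.ncard_union_eq h3 (Set.toFinite _) (Set.toFinite _),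
      Set.ncard_union_eq (disjoint_after _ _) (Set.toFinite _) (Set.toFinite _),
      Set.ncard_singleton]
  -- The share of the first edge, `10 * n + 10`, pays for its own report, for the additional scan
  -- and for leaving both loops.
  refine Reaches.mono (T := 4 + (((10 * n + 10) *
    (After P σ 1 (s.var 0) (s.var 1) (s.var 1)).ncard + 1) + (1 + ((5 * n + 2) +
    ((10 * n + 10) * (After P σ (-1) (s.var 0) (s.var 1) (s.var 1)).ncard + 1))))) ?_
    (by rw [hcard]; simp only [Nat.mul_add]; omega) fun _ h => h
  refine ((reaches_reportEdge hP hn hσ (.inl rfl) (by rwa [h2]) (by rwa [h2])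
    (by rwa [h2])).mono le_rfl ?_).seq
  rintro s₁ ⟨hv, L₁, o1, hL₁⟩
  rw [h2] at hL₁
  have hw := reaches_walk (s := s₁) hP hn hσ (.inl rfl) (by rwa [hv, h2]) (by rw [hv]; exact .inl h2)
    (by rwa [hv, h2])
  rw [hv, h2] at hw
  refine (hw.mono le_rfl ?_).seq
  rintro s₂ ⟨v0, v1, L₂, o2, hL₂⟩
  refine (reaches_copy ((reaches_findEnd (.inl rfl) (by omega)).mono le_rfl ?_).seq).seq
  rintro s₃ ⟨o3, hx, he3⟩
  have w0 : s₃.var 0 = s.var 0 := by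
    rw [hx 0 (by omega) (by omega), Store.set_var_of_ne _ (by omega), v0]
  have w1 : s₃.var 1 = s.var 1 := by
    rw [hx 1 (by omega) (by omega), Store.set_var_of_ne _ (by omega), v1]
  have w2 : s₃.var 2 = s.var 1 := by
    rw [hx 2 (by omega) (by omega), Store.set_var_self, v1]
  rw [Store.set_var_of_ne _ (by omega), Store.set_var_self, v0, v1] at he3
  have hw := reaches_walk (s := s₃) hP hn hσ (.inr rfl) (by rwa [w0, w2]) (by rw [w1, w2]; exact .inl rfl)
    (by rwa [w0, w2])
  rw [w0, w1, w2] at hw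
  refine hw.mono le_rfl ?_
  rintro s₄ ⟨x0, x1, L₃, o4, hL₃⟩
  refine ⟨x0, L₁ ++ (L₂ ++ L₃), ?_, ?_⟩
  · have o3' : s₃.out = s₂.out := o3
    rw [o4, o3', o2, o1]; simp only [List.append_assoc]
  · rw [hU]
    refine hL₁.pairsAbove_append (hL₂.pairsAbove_append hL₃ (disjoint_after _ _)) ?_
    rw [Set.disjoint_singleton_left, Set.mem_union]
    exact fun h => h.elim After.notMem_self After.notMem_self

/-- `γ` selects an edge of the cell of `i`, if there is one. -/
def SelectsEdge (P : Sites n) (σ : ℤ) (γ : Fin n → Fin n → Fin n → ℤ) : Prop :=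
  ∀ i j w, IsEdge P σ i j → 0 < sqDist P i w →
    (Selective (sqDist P i) (γ i) → ∀ k, 0 < sqDist P i k → ¬ 0 < γ i w k) → IsEdge P σ i w

theorem reaches_cell (hP : Generic P) (hn : 3 ≤ n) (hσ : σ = 1 ∨ σ = -1) {G : Expr}
    {γ : Fin n → Fin n → Fin n → ℤ} (hG : ∀ u, G.eval P u = γ (u 0) (u 1) (u 5))
    (hγ : SelectsEdge P σ γ) :
    Reaches P (.cell σ G)
      ((10 * n + 10) * (neighbors P σ (s.var 0)).card + (15 * n + 9)) s fun s' =>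
      s'.var 0 = s.var 0 ∧ ∃ L, s'.out = s.out ++ L ∧
        Lists P σ (pairsAbove (s.var 0) {l | IsEdge P σ (s.var 0) l}) L := by
  refine Reaches.mono (T := 1 + ((5 * n + 1) + (1 + ((10 * n + 4) +
    ((10 * n + 10) * (neighbors P σ (s.var 0)).card + 1 + 1))))) ?_ (by omega) fun _ h => h
  refine (reaches_copy ((reaches_select (by omega) (by omega) (sqDist P (s.var 0))
    (γ (s.var 0)) fun u hu => ?_).mono le_rfl ?_).seq).seq
  · have h0 : u 0 = s.var 0 := hu 0 (by omega) (by omega)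
    rw [hG, ← h0]
    exact ⟨rfl, rfl, rfl⟩
  rintro s₁ ⟨o1, hx, hsel⟩
  have v0 : s₁.var 0 = s.var 0 := hx 0 (by omega) (by omega)
  refine (reaches_copy ((reaches_findEnds (by omega)).mono le_rfl ?_).seq).seq
  rintro s₂ ⟨o2, w0, w1, w2, he, hg⟩
  rw [Store.set_var_of_ne _ (by omega)] at w0 w1
  rw [Store.set_var_self] at w2
  rw [Store.set_var_of_ne _ (by omega), Store.set_var_self] at he hg
  rw [v0] at w0 he hg
  have hout : s₂.out = s.out := o2.trans o1
  have hpos : 0 < sqDist P (s.var 0) (s₁.var 1) := by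
    rcases hsel with ⟨-, h⟩ | h
    · exfalso
      obtain ⟨k, hk⟩ : ∃ k, s.var 0 ≠ k := by
        have : Nontrivial (Fin n) := Fin.nontrivial_iff_two_le.2 (by omega)
        obtain ⟨k, hk⟩ := exists_ne (s.var 0)
        exact ⟨k, hk.symm⟩
      exact h k ((sqDist_pos_iff hP).2 hk)
    · exact h.1
  -- If the cell has any edge, the candidate gives one; so a failed edge test of the candidate shows
  -- that the cell has none.
  have hstart : ∀ j, IsEdge P σ (s.var 0) j → IsEdge P σ (s.var 0) (s₁.var 1) := fun j hj =>
    hγ _ j _ hj hpos ((hsel.resolve_left fun h => h.2 _ hpos).2)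
  have htest := isEdge_iff_of_ends hP hσ (.inl rfl) ((sqDist_pos_iff hP).1 hpos) he hg
  have e1 : (Expr.mul (.const (-1)) (.mul (.det 0 2 3) (.det 0 2 4))).eval P s₂.var =
      -(det P (s.var 0) (s₁.var 1) (s₂.var 3) * det P (s.var 0) (s₁.var 1) (s₂.var 4)) := by
    rw [← w0, ← w2]; exact neg_one_mul _
  have e2 : (Expr.compare σ 0 2 4 3).eval P s₂.var =
      σ * 1 * (num P (s.var 0) (s₁.var 1) (s₂.var 4) * det P (s.var 0) (s₁.var 1) (s₂.var 3) -
        num P (s.var 0) (s₁.var 1) (s₂.var 3) * det P (s.var 0) (s₁.var 1) (s₂.var 4)) := by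
    rw [← w0, ← w2, mul_one]; rfl
  rw [← e1, ← e2] at htest
  have hwalk : IsEdge P σ (s.var 0) (s₁.var 1) → Reaches P (.walkBoth σ)
      ((10 * n + 10) * (neighbors P σ (s.var 0)).card) s₂ fun s' =>
      s'.var 0 = s.var 0 ∧ ∃ L, s'.out = s.out ++ L ∧
        Lists P σ (pairsAbove (s.var 0) {l | IsEdge P σ (s.var 0) l}) L := by
    intro h
    have := reaches_walkBoth (s := s₂) hP hn hσ (by rwa [w0, w1]) (w2.trans w1.symm)
      (by rwa [w0, w1]) (by rwa [w0, w1])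
    rwa [w0, hout] at this
  refine reaches_ite (fun c1 => reaches_ite (fun c2 => hwalk (htest.2 fun h => h.2 c2)) fun c2 => ?_)
    fun c1 => (hwalk (htest.2 fun h => c1 h.1)).mono (by omega) fun _ h => h
  have hno : {l | IsEdge P σ (s.var 0) l} = ∅ :=
    Set.eq_empty_iff_forall_notMem.2 fun l hl => htest.1 (hstart l hl) ⟨c1, c2⟩
  refine (reaches_skip ⟨w0, [], by simp [hout], ?_⟩).mono (by omega) fun _ h => h
  rw [hno, pairsAbove_empty]
  exact Lists.nil

theorem reaches_diagram (hP : Generic P) (hn : 3 ≤ n) (hσ : σ = 1 ∨ σ = -1) {G : Expr}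
    {γ : Fin n → Fin n → Fin n → ℤ} (hG : ∀ u, G.eval P u = γ (u 0) (u 1) (u 5))
    (hγ : SelectsEdge P σ γ) :
    Reaches P (.diagram σ G) (300 * n ^ 2) ⟨fun _ => ⟨0, by omega⟩, []⟩ fun s' =>
      Lists P σ {z | z.1 < z.2 ∧ IsEdge P σ z.1 z.2} s'.out := by
  let T : ℕ → ℕ := fun j => if h : j < n then
    (10 * n + 10) * (neighbors P σ ⟨j, h⟩).card + (15 * n + 9) else 0
  have hT : ∀ j : Fin n, T j = (10 * n + 10) * (neighbors P σ j).card + (15 * n + 9) :=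
    fun j => by simp [T]
  refine Reaches.mono (reaches_all (fun j s' =>
    Lists P σ {z | (z.1 : ℕ) < j ∧ z.1 < z.2 ∧ IsEdge P σ z.1 z.2} s'.out) T ?_ ?_ ⟨0, by omega⟩
    rfl fun s₁ h => ?_) ?_ fun _ h => h
  · have : {z : Fin n × Fin n | (z.1 : ℕ) < 0 ∧ z.1 < z.2 ∧ IsEdge P σ z.1 z.2} = ∅ := by
      ext z; simp
    rw [this]
    exact Lists.nil
  · intro j s₁ hL
    have := reaches_cell (s := s₁.set 0 j) hP hn hσ hG hγ
    rw [Store.set_var_self] at this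
    rw [hT]
    refine this.mono le_rfl ?_
    rintro s₂ ⟨h0, L, ho, hL'⟩
    refine ⟨h0, ?_⟩
    have hU : {z : Fin n × Fin n | (z.1 : ℕ) < j + 1 ∧ z.1 < z.2 ∧ IsEdge P σ z.1 z.2} =
        {z | (z.1 : ℕ) < j ∧ z.1 < z.2 ∧ IsEdge P σ z.1 z.2} ∪
          pairsAbove j {l | IsEdge P σ j l} := by
      ext ⟨z, w⟩
      simp only [pairsAbove, Set.mem_ofPred_eq, Set.mem_union]
      rw [Nat.lt_succ_iff_lt_or_eq, ← Fin.ext_iff]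
      constructor
      · rintro ⟨h | rfl, h1, h2⟩
        · exact .inl ⟨h, h1, h2⟩
        · exact .inr ⟨rfl, h2, h1⟩
      · rintro (⟨h, h1, h2⟩ | ⟨rfl, h2, h1⟩)
        · exact ⟨.inl h, h1, h2⟩
        · exact ⟨.inr rfl, h1, h2⟩
    rw [ho, hU]
    refine hL.append hL' (Set.disjoint_left.2 fun z hz hz' => ?_)
    have h1 := hz.1
    rw [hz'.1] at h1
    omega
  · have : {z : Fin n × Fin n | (z.1 : ℕ) < n ∧ z.1 < z.2 ∧ IsEdge P σ z.1 z.2} =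
        {z | z.1 < z.2 ∧ IsEdge P σ z.1 z.2} := by
      ext z; simp
    rwa [this] at h
  · have h1 := sum_card_neighbors_le hP hσ hn
    have h2 : ∑ j ∈ Finset.range n, (T j + 1) =
        (10 * n + 10) * ∑ j, (neighbors P σ j).card + n * (15 * n + 10) := by
      rw [Finset.sum_range, Finset.mul_sum]
      simp only [hT, Finset.sum_add_distrib, Finset.sum_const, Finset.card_univ, Fintype.card_fin,
        smul_eq_mul]
      ring
    rw [h2]
    -- The total is at most `135 * n ^ 2 + 130 * n + 1`.
    have h3 := Nat.mul_le_mul_left (10 * n + 10) h1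
    nlinarith

/-- The lists produced by the program report every edge once. -/
theorem Lists.reportsEachEdgeOnce {edge : Fin n → Fin n → Set Plane} {L : List (EdgeRecord ℤ)}
    (hedge : ∀ i j, i ≠ j → edge i j = edgeSet P σ i j)
    (h : Lists P σ {z | z.1 < z.2 ∧ IsEdge P σ z.1 z.2} L) : ReportsEachEdgeOnce edge L := by
  have hne : ∀ i j : Fin n, i ≠ j → ((edgeSet P σ i j).Nonempty ↔ IsEdge P σ i j) := by
    refine fun i j hij => ⟨fun ⟨z, hz⟩ => ⟨hij, z 0, z 1, hz⟩, fun ⟨_, a, b, hab⟩ =>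
      ⟨!₂[a, b], ?_⟩⟩
    simpa [edgeSet] using hab
  have hsymm : ∀ i j : Fin n, edgeSet P σ i j = edgeSet P σ j i := by
    have : ∀ i j : Fin n, edgeSet P σ i j ⊆ edgeSet P σ j i := fun i j z hz =>
      ⟨hz.1.symm, fun k hj hi => by rw [hz.1]; exact hz.2 k hi hj⟩
    exact fun i j => (this i j).antisymm (this j i)
  refine ⟨fun r hr => ?_, fun i j hij hn => ?_, ?_⟩
  · obtain ⟨z, ⟨hz, hz'⟩, h1, h2, h3, h4, h5⟩ := h.sound r hr
    exact ⟨z.1, z.2, hz.ne, h1, h2, h3, h4, by rwa [hedge _ _ hz.ne, hne _ _ hz.ne],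
      by rw [h5, hedge _ _ hz.ne]⟩
  · rw [hedge i j hij, hne i j hij] at hn
    have key : ∀ i j : Fin n, i < j → IsEdge P σ i j → ∃ r ∈ L, r.carrier = edgeSet P σ i j := by
      intro i j hij he
      obtain ⟨r, hr, h1, h2⟩ := h.complete (i, j) ⟨hij, he⟩
      obtain ⟨z, -, h3, h4, -, -, h5⟩ := h.sound r hr
      rw [h1, Nat.cast_inj, Fin.val_inj] at h3
      rw [h2, Nat.cast_inj, Fin.val_inj] at h4
      exact ⟨r, hr, by rw [h5, ← h3, ← h4]⟩
    rw [hedge i j hij]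
    rcases hij.lt_or_gt with hlt | hlt
    · exact key i j hlt hn
    · rw [hsymm]; exact key j i hlt hn.symm
  · have hnd := h.nodup
    refine (List.nodup_map_iff_inj_on hnd.of_map).2 fun r hr r' hr' heq => ?_
    obtain ⟨⟨i, j⟩, ⟨hij, he⟩, h1, h2, -, -, h5⟩ := h.sound r hr
    obtain ⟨⟨i', j'⟩, ⟨hij', he'⟩, h1', h2', -, -, h5'⟩ := h.sound r' hr'
    dsimp only at *
    obtain ⟨z, hz⟩ := (hne i j hij.ne).2 he
    have hz' : z ∈ edgeSet P σ i' j' := by rw [← h5', ← heq, h5]; exact hz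
    -- Distinct site pairs have distinct carriers: a point on an edge determines the unordered pair,
    -- since any third site is strictly farther, or nearer for `σ = -1`. The order is fixed by `i <
    -- j`.
    have mem : ∀ i j i' j' : Fin n, z ∈ edgeSet P σ i j → z ∈ edgeSet P σ i' j' →
        i' = i ∨ i' = j := by
      intro i j i' j' hz hz'
      by_contra! hcon
      have e1 := hz.2 i' hcon.1 hcon.2
      by_cases c1 : i = i'
      · exact hcon.1 c1.symm
      by_cases c2 : i = j'
      · have := hz'.1
        rw [← c2] at this
        rw [this, sub_self, mul_zero] at e1
        exact lt_irrefl _ e1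
      · have e2 := hz'.2 i c1 c2
        linarith
    have m1 := mem i j i' j' hz hz'
    have m2 := mem i j j' i' hz (hsymm i' j' ▸ hz')
    have m3 : i' = i ∧ j' = j := by
      rcases m1 with rfl | rfl <;> rcases m2 with rfl | rfl
      · exact absurd rfl hij'.ne
      · exact ⟨rfl, rfl⟩
      · exact absurd hij' hij.not_gt
      · exact absurd rfl hij'.ne
    refine List.inj_on_of_nodup_map hnd hr hr' ?_
    rw [h1, h2, h1', h2', m3.1, m3.2]

end Correctness

/-- The diagrams differ only in `σ` and in the expression `G` that selects the first edge of a cell.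
Both are fixed before `n` and `b`, so a single program serves all inputs. -/
theorem exists_program_diagram (σ : ℤ) (hσ : σ = 1 ∨ σ = -1)
    (edge : ∀ {n : ℕ}, (Fin n → Plane) → Fin n → Fin n → Set Plane)
    (hedge : ∀ {n : ℕ} (P : Sites n) (i j : Fin n), i ≠ j → edge P.point i j = edgeSet P σ i j)
    (G : Expr) (γ : ∀ {n : ℕ}, Sites n → Fin n → Fin n → Fin n → ℤ)
    (hG : ∀ {n : ℕ} (P : Sites n) (u : ℕ → Fin n), G.eval P u = γ P (u 0) (u 1) (u 5))
    (hγ : ∀ {n : ℕ} (P : Sites n), Generic P → SelectsEdge P σ (γ P)) :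
    ∃ (k : ℕ) (prog : List (Instr k)) (C : ℕ), ∀ b : ℕ, ∃ c : ℕ,
      ∀ (n : ℕ) (P : Sites n), 3 ≤ n → GeneralPosition P.point →
        (∀ i, |P.x i| ≤ (n : ℤ) ^ b ∧ |P.y i| ≤ (n : ℤ) ^ b) →
        ∃ out : List (EdgeRecord ℤ), HaltsWithin prog (n ^ c) P (C * n ^ 2) out ∧
          ReportsEachEdgeOnce (edge P.point) out := by
  obtain ⟨k, prog, A, h⟩ := exists_program (.diagram σ G)
  refine ⟨k, prog, A * 300, fun b => ?_⟩
  obtain ⟨c, hc⟩ := h b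
  refine ⟨c, fun n P hn hgp hb => ?_⟩
  have hP := hgp.generic
  obtain ⟨s', t, hex, ht, hL⟩ := reaches_diagram hP hn hσ (hG P) (hγ P hP)
  obtain ⟨t', ht', cfg, hrun⟩ := hc n P hn hb ⟨0, by omega⟩ s' t rfl hex
  refine ⟨s'.out, ⟨t', ht'.trans ?_, cfg, hrun⟩, hL.reportsEachEdgeOnce (hedge P)⟩
  rw [Nat.mul_assoc]
  exact Nat.mul_le_mul_left A ht

end VoronoiRAM

theorem theorem1 :
    (∃ (k : ℕ) (prog : List (VoronoiRAM.Instr k)) (C : ℕ), ∀ b : ℕ, ∃ c : ℕ,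
      ∀ (n : ℕ) (P : VoronoiRAM.Sites n), 3 ≤ n → VoronoiRAM.GeneralPosition P.point →
        (∀ i, |P.x i| ≤ (n : ℤ) ^ b ∧ |P.y i| ≤ (n : ℤ) ^ b) →
        ∃ out : List (VoronoiRAM.EdgeRecord ℤ),
          VoronoiRAM.HaltsWithin prog (n ^ c) P (C * n ^ 2) out ∧
          VoronoiRAM.ReportsEachEdgeOnce (VoronoiRAM.nvdEdge P.point) out) ∧
    (∃ (k : ℕ) (prog : List (VoronoiRAM.Instr k)) (C : ℕ), ∀ b : ℕ, ∃ c : ℕ,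
      ∀ (n : ℕ) (P : VoronoiRAM.Sites n), 3 ≤ n → VoronoiRAM.GeneralPosition P.point →
        (∀ i, |P.x i| ≤ (n : ℤ) ^ b ∧ |P.y i| ≤ (n : ℤ) ^ b) →
        ∃ out : List (VoronoiRAM.EdgeRecord ℤ),
          VoronoiRAM.HaltsWithin prog (n ^ c) P (C * n ^ 2) out ∧
          VoronoiRAM.ReportsEachEdgeOnce (VoronoiRAM.fvdEdge P.point) out) :=
  ⟨VoronoiRAM.exists_program_diagram 1 (.inl rfl) VoronoiRAM.nvdEdge
      (fun _ _ _ h => VoronoiRAM.nvdEdge_eq h)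
      (.sub (.sqDist 0 1) (.sqDist 0 5))
      (fun P i w k => VoronoiRAM.sqDist P i w - VoronoiRAM.sqDist P i k) (fun _ _ => rfl)
      fun _ hP i _ _ _ hw h => VoronoiRAM.isEdge_of_nearest hP hw
        (h (VoronoiRAM.selective_nearest i)),
    VoronoiRAM.exists_program_diagram (-1) (.inr rfl) VoronoiRAM.fvdEdge
      (fun _ _ _ h => VoronoiRAM.fvdEdge_eq h)
      (.det 0 5 1) (fun P i w k => VoronoiRAM.det P i k w) (fun _ _ => rfl)
      fun _ hP _ _ _ hj hw h => VoronoiRAM.isEdge_of_extreme hP hw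
        (h (VoronoiRAM.selective_extreme hP hj))⟩
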